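/- **Setting.** Let $n\ge 1$, $\alpha>n/2$ and $\mu\in\{1,-1\}$. For $k\ge1$ let $\mathrm H^\alpha_k$ be the space of $\gamma=\gamma(\mathbf x_k;\mathbf x'_k)\in L^2(\mathbb R^{kn}\times\mathbb R^{kn};\mathbb C)$, $\mathbf x_k=(x_1,\dots,x_k)$, $\mathbf x'_k=(x'_1,\dots,x'_k)$, which are symmetric, i.e. $\gamma(\mathbf x_k;\mathbf x'_k)=\overline{\gamma(\mathbf x'_k;\mathbf x_k)}$ and $\gamma$ is unchanged when the same permutation is applied to $(x_1,\dots,x_k)$ and $(x'_1,\dots,x'_k)$, and for which $$\|\gamma\|_{\mathrm H^\alpha_k}=\Big\|\prod_{j=1}^k(1-\Delta_{x_j})^{\alpha/2}(1-\Delta_{x'_j})^{\alpha/2}\gamma\Big\|_{L^2}<\infty .$$ Let $\mathcal H^\alpha$ be the set of sequences $\Gamma=\{\gamma^{(k)}\}_{k\ge1}$, $\gamma^{(k)}\in\mathrm H^\alpha_k$, with $\sum_k\lambda^{-k}\|\gamma^{(k)}\|_{\mathrm H^\alpha_k}<\infty$ for some $\lambda>0$, with the quasi-norm $$\|\Gamma\|_{\mathcal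 H^\alpha}=\tfrac12\inf\Big\{\lambda>0:\ \sum_{k\ge1}\lambda^{-k}\|\gamma^{(k)}\|_{\mathrm H^\alpha_k}\le1\Big\}.$$ For $T>0$ let $C([0,T],\mathcal H^\alpha)$ be the set of $\Gamma(t)=\{\gamma^{(k)}_t\}_{k\ge1}$, $t\in[0,T]$, such that $\gamma^{(k)}\in C([0,T],\mathrm H^\alpha_k)$ for every $k$ and $\sum_k\lambda^{-k}\sup_{t\in[0,T]}\|\gamma^{(k)}_t\|_{\mathrm H^\alpha_k}<\infty$ for some $\lambda>0$, with $$\|\Gamma\|_{C([0,T],\mathcal H^\alpha)}=\tfrac12\inf\Big\{\lambda>0:\ \sum_{k\ge1}\lambda^{-k}\sup_{t\in[0,T]}\|\gamma^{(k)}_t\|_{\mathrm H^\alpha_k}\le1\Big\}\ \ \Big(\ge\sup_{t\in[0,T]}\|\Gamma(t)\|_{\mathcal H^\alpha}\Big).$$ Put $\Delta^{(k)}_\pm=\sum_{j=1}^k(\Delta_{x_j}-\Delta_{x'_j})$ and $$B^{(k)}\gamma^{(k+1)}(\mathbf x_k;\mathbf x'_k)=\sum_{j=1}^k\big[\gamma^{(k+1)}(\mathbf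 x_k,x_j;\mathbf x'_k,x_j)-\gamma^{(k+1)}(\mathbf x_k,x'_j;\mathbf x'_k,x'_j)\big],$$ evaluated on the continuous representative of $\gamma^{(k+1)}$. A *solution* on $[0,T]$ of the cubic Gross–Pitaevskii hierarchy $(i\partial_t+\Delta^{(k)}_\pm)\gamma^{(k)}_t=\mu B^{(k)}\gamma^{(k+1)}_t$, $k\ge1$, with initial data $\Gamma_0=\{\gamma^{(k)}_0\}_{k\ge1}$ is a $\Gamma\in C([0,T],\mathcal H^\alpha)$ such that for every $k\ge1$ and $t\in[0,T]$ $$\gamma^{(k)}_t=e^{it\Delta^{(k)}_\pm}\gamma^{(k)}_0-i\mu\int_0^t e^{i(t-s)\Delta^{(k)}_\pm}B^{(k)}\gamma^{(k+1)}_s\,ds$$ (a Bochner integral in the Sobolev norm $\|\cdot\|_{\mathrm H^\alpha_k}$). **Theorem 2.1.** For $n\ge1$ and $\alpha>n/2$ the cubic Gross–Pitaevskii hierarchy is locally well posed in $\mathcal H^\alpha$. More precisely, there is a constant $C=C_{n,\alpha}>0$, depending only on $n$ and $\alpha$, such that for $\mu=\pm1$: (i) For every $\Gamma_0\in\mathcal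 H^\alpha$ and every $T>0$ with $4C\|\Gamma_0\|_{\mathcal H^\alpha}T\le1$ (in particular $T=1/(4C\|\Gamma_0\|_{\mathcal H^\alpha})$ if $\Gamma_0\ne0$) there is a solution $\Gamma\in C([0,T],\mathcal H^\alpha)$ with initial data $\Gamma_0$ and $$\|\Gamma\|_{C([0,T],\mathcal H^\alpha)}\le2\|\Gamma_0\|_{\mathcal H^\alpha}.$$ (ii) Let $T_0>0$ and let $\Gamma,\Gamma'\in C([0,T_0],\mathcal H^\alpha)$ be two solutions with initial data $\Gamma_0,\Gamma'_0\in\mathcal H^\alpha$. Then $$\|\Gamma-\Gamma'\|_{C([0,T],\mathcal H^\alpha)}\le2\|\Gamma_0-\Gamma'_0\|_{\mathcal H^\alpha}$$ for every $0<T\le T_0$ with $4C\|\Gamma-\Gamma'\|_{C([0,T_0],\mathcal H^\alpha)}T\le1$ (in particular for $T=\min\{T_0,\ 1/(4C\|\Gamma-\Gamma'\|_{C([0,T_0],\mathcal H^\alpha)})\}$ if $\Gamma\ne\Gamma'$). -/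

import Mathlib

open MeasureTheory Set
open scoped FourierTransform ENNReal Interval

noncomputable section

namespace GP

/-- The space `ℝ^{kn} × ℝ^{kn}` of points `(𝐱_k; 𝐱'_k)`, with its Euclidean structure and Lebesgue
measure. The particle label `Sum.inl j` stands for `x_j` and `Sum.inr j` for `x'_j`; the second
index is the coordinate in `ℝ^n`. -/
abbrev Conf (n k : ℕ) : Type := EuclideanSpace ℝ ((Fin k ⊕ Fin k) × Fin n)

/-- `L²(ℝ^{kn} × ℝ^{kn}; ℂ)`. -/
abbrev L2 (n k : ℕ) : Type := Lp ℂ 2 (volume : Measure (Conf n k))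

/-- The Fourier symbol `4π²|ξ_i|²` of `-Δ` in the variable of the particle labelled `i`
(Mathlib's Fourier transform uses the kernel `exp (-2πi x·ξ)`). -/
def lapSymbol {n k : ℕ} (ξ : Conf n k) (i : Fin k ⊕ Fin k) : ℝ :=
  (2 * Real.pi) ^ 2 * ∑ a, ξ (i, a) ^ 2

/-- The Fourier symbol `∏_i (1 + 4π²|ξ_i|²)^{α/2}`, over all the `2k` particle variables, of
`S^{(k,α)} = ∏_j (1 - Δ_{x_j})^{α/2} (1 - Δ_{x'_j})^{α/2}`. -/
def sobolevSymbol {n k : ℕ} (α : ℝ) (ξ : Conf n k) : ℝ :=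
  ∏ i, (1 + lapSymbol ξ i) ^ (α / 2)

/-- The Fourier symbol `exp (i t (-∑_j |2πξ_j|² + ∑_j |2πξ'_j|²))` of `exp (i t Δ_±^{(k)})`. -/
def propSymbol {n k : ℕ} (t : ℝ) (ξ : Conf n k) : ℂ :=
  Complex.exp (((t * (-∑ j, lapSymbol ξ (Sum.inl j) + ∑ j, lapSymbol ξ (Sum.inr j)) : ℝ) : ℂ)
    * Complex.I)

theorem continuous_lapSymbol {n k : ℕ} (i : Fin k ⊕ Fin k) :
    Continuous fun ξ : Conf n k => lapSymbol ξ i := by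
  unfold lapSymbol
  fun_prop

theorem lapSymbol_nonneg {n k : ℕ} (ξ : Conf n k) (i : Fin k ⊕ Fin k) : 0 ≤ lapSymbol ξ i := by
  unfold lapSymbol
  positivity

theorem sobolevSymbol_pos {n k : ℕ} (α : ℝ) (ξ : Conf n k) : 0 < sobolevSymbol α ξ :=
  Finset.prod_pos fun i _ => Real.rpow_pos_of_pos (by linarith [lapSymbol_nonneg ξ i]) _

theorem continuous_sobolevSymbol {n k : ℕ} (α : ℝ) :
    Continuous fun ξ : Conf n k => sobolevSymbol α ξ := by
  unfold sobolevSymbol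
  refine continuous_finsetProd _ fun i _ => ?_
  refine (continuous_const.add (continuous_lapSymbol i)).rpow_const fun ξ => Or.inl ?_
  have h := lapSymbol_nonneg ξ i
  exact (by linarith : (0 : ℝ) < 1 + lapSymbol ξ i).ne'

theorem continuous_propSymbol {n k : ℕ} (t : ℝ) :
    Continuous fun ξ : Conf n k => propSymbol t ξ := by
  unfold propSymbol
  have h := fun i : Fin k ⊕ Fin k => continuous_lapSymbol (n := n) i
  fun_prop

theorem norm_propSymbol {n k : ℕ} (t : ℝ) (ξ : Conf n k) : ‖propSymbol t ξ‖ = 1 :=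
  Complex.norm_exp_ofReal_mul_I _

/-- The functions `γ ∈ L²` with `S^{(k,α)} γ ∈ L²`, as a subspace of `L²`. -/
def sobolevSubmodule (n k : ℕ) (α : ℝ) : Submodule ℂ (L2 n k) where
  carrier := {γ | MemLp (fun ξ => (sobolevSymbol α ξ : ℂ) * (𝓕 γ : L2 n k) ξ) 2 volume}
  zero_mem' := by
    have h0 : (𝓕 (0 : L2 n k) : L2 n k) = 0 := (Lp.fourierTransformₗᵢ (Conf n k) ℂ).map_zero
    have h : (fun ξ => (sobolevSymbol α ξ : ℂ) * (𝓕 (0 : L2 n k) : L2 n k) ξ)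
        =ᵐ[volume] fun _ => (0 : ℂ) := by
      rw [h0]
      filter_upwards [Lp.coeFn_zero ℂ 2 (volume : Measure (Conf n k))] with ξ hξ
      rw [hξ]
      exact mul_zero _
    exact (memLp_congr_ae h).2 MemLp.zero'
  add_mem' := by
    intro γ ρ hγ hρ
    have h0 : (𝓕 (γ + ρ) : L2 n k) = 𝓕 γ + 𝓕 ρ :=
      (Lp.fourierTransformₗᵢ (Conf n k) ℂ).map_add γ ρ
    refine (memLp_congr_ae ?_).2 (MemLp.add hγ hρ)
    rw [h0]
    filter_upwards [Lp.coeFn_add (𝓕 γ : L2 n k) (𝓕 ρ : L2 n k)] with ξ hξ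
    rw [hξ]
    exact mul_add _ _ _
  smul_mem' := by
    intro c γ hγ
    have h0 : (𝓕 (c • γ) : L2 n k) = c • 𝓕 γ :=
      (Lp.fourierTransformₗᵢ (Conf n k) ℂ).map_smul c γ
    refine (memLp_congr_ae ?_).2 (MemLp.const_smul hγ c)
    rw [h0]
    filter_upwards [Lp.coeFn_smul c (𝓕 γ : L2 n k)] with ξ hξ
    rw [hξ]
    exact mul_left_comm _ _ _

/-- The Sobolev space `H^α(ℝ^{kn} × ℝ^{kn})` with the norm `‖S^{(k,α)} γ‖_{L²}`. The symmetry of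
density matrices is the separate predicate `IsSymm`. -/
def Sob (n k : ℕ) (α : ℝ) : Type := sobolevSubmodule n k α

instance (n k : ℕ) (α : ℝ) : AddCommGroup (Sob n k α) :=
  inferInstanceAs (AddCommGroup (sobolevSubmodule n k α))

instance (n k : ℕ) (α : ℝ) : Module ℂ (Sob n k α) :=
  inferInstanceAs (Module ℂ (sobolevSubmodule n k α))

/-- The underlying element of `L²`. -/
def Sob.toL2 {n k : ℕ} {α : ℝ} (γ : Sob n k α) : L2 n k := γ.1

theorem Sob.memLp {n k : ℕ} {α : ℝ} (γ : Sob n k α) :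
    MemLp (fun ξ => (sobolevSymbol α ξ : ℂ) * (𝓕 γ.toL2 : L2 n k) ξ) 2 volume := γ.2

/-- The Fourier transform of `S^{(k,α)} γ`, an element of `L²`. -/
def Sob.weighted {n k : ℕ} {α : ℝ} : Sob n k α →ₗ[ℂ] L2 n k where
  toFun γ := MemLp.toLp (fun ξ => (sobolevSymbol α ξ : ℂ) * (𝓕 γ.toL2 : L2 n k) ξ) γ.memLp
  map_add' γ ρ := by
    have h0 : (𝓕 (γ + ρ).toL2 : L2 n k) = 𝓕 γ.toL2 + 𝓕 ρ.toL2 :=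
      (Lp.fourierTransformₗᵢ (Conf n k) ℂ).map_add γ.toL2 ρ.toL2
    refine (MemLp.toLp_congr _ (γ.memLp.add ρ.memLp) ?_).trans
      (MemLp.toLp_add γ.memLp ρ.memLp)
    rw [h0]
    filter_upwards [Lp.coeFn_add (𝓕 γ.toL2 : L2 n k) (𝓕 ρ.toL2 : L2 n k)] with ξ hξ
    rw [hξ]
    exact mul_add _ _ _
  map_smul' c γ := by
    have h0 : (𝓕 (c • γ).toL2 : L2 n k) = c • 𝓕 γ.toL2 :=
      (Lp.fourierTransformₗᵢ (Conf n k) ℂ).map_smul c γ.toL2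
    refine (MemLp.toLp_congr _ (γ.memLp.const_smul c) ?_).trans
      (MemLp.toLp_const_smul c γ.memLp)
    rw [h0]
    filter_upwards [Lp.coeFn_smul c (𝓕 γ.toL2 : L2 n k)] with ξ hξ
    rw [hξ]
    exact mul_left_comm _ _ _

theorem Sob.weighted_injective {n k : ℕ} {α : ℝ} :
    Function.Injective (Sob.weighted : Sob n k α →ₗ[ℂ] L2 n k) := by
  intro γ ρ h
  have h1 := (MemLp.toLp_eq_toLp_iff γ.memLp ρ.memLp).1 h
  have h2 : (𝓕 γ.toL2 : L2 n k) = 𝓕 ρ.toL2 := by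
    refine Lp.ext ?_
    filter_upwards [h1] with ξ hξ
    exact mul_left_cancel₀ (by exact_mod_cast (sobolevSymbol_pos α ξ).ne') hξ
  exact Subtype.ext ((Lp.fourierTransformₗᵢ (Conf n k) ℂ).injective h2)

/-- `‖γ‖ = ‖S^{(k,α)} γ‖_{L²}`, computed on the Fourier side (Plancherel). -/
instance (n k : ℕ) (α : ℝ) : NormedAddCommGroup (Sob n k α) :=
  NormedAddCommGroup.induced (Sob n k α) (L2 n k) Sob.weighted Sob.weighted_injective

instance (n k : ℕ) (α : ℝ) : NormedSpace ℂ (Sob n k α) :=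
  NormedSpace.induced ℂ (Sob n k α) (L2 n k) Sob.weighted

/-- `H^α` is complete when `α ≥ 0`, so that Bochner integrals in it are meaningful. -/
theorem Sob.completeSpace (n k : ℕ) {α : ℝ} (hα : 0 ≤ α) : CompleteSpace (Sob n k α) := by
  have hiso : Isometry (Sob.weighted : Sob n k α →ₗ[ℂ] L2 n k) :=
    AddMonoidHomClass.isometry_of_norm _ fun _ => rfl
  have hone : ∀ ξ : Conf n k, 1 ≤ sobolevSymbol α ξ := fun ξ =>
    Finset.one_le_prod fun i _ =>
      Real.one_le_rpow (by linarith [lapSymbol_nonneg ξ i]) (by positivity)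
  have hsurj : Function.Surjective (Sob.weighted : Sob n k α →ₗ[ℂ] L2 n k) := by
    intro f
    have hm : MemLp (fun ξ => (((sobolevSymbol α ξ)⁻¹ : ℝ) : ℂ) * f ξ) 2 volume := by
      refine (Lp.memLp f).mono ?_ (Filter.Eventually.of_forall fun ξ => ?_)
      · have hc : Continuous fun ξ : Conf n k => (((sobolevSymbol α ξ)⁻¹ : ℝ) : ℂ) :=
          Complex.continuous_ofReal.comp
            ((continuous_sobolevSymbol α).inv₀ fun ξ => (sobolevSymbol_pos α ξ).ne')
        exact hc.aestronglyMeasurable.mul (Lp.aestronglyMeasurable f)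
      · rw [norm_mul, Complex.norm_real, Real.norm_of_nonneg (inv_nonneg.2 (sobolevSymbol_pos α ξ).le)]
        exact mul_le_of_le_one_left (norm_nonneg _) (inv_le_one_of_one_le₀ (hone ξ))
    have hF : (𝓕 (𝓕⁻ (hm.toLp) : L2 n k) : L2 n k) = hm.toLp :=
      (Lp.fourierTransformₗᵢ (Conf n k) ℂ).apply_symm_apply _
    have hae : (fun ξ => (sobolevSymbol α ξ : ℂ) * (𝓕 (𝓕⁻ (hm.toLp) : L2 n k) : L2 n k) ξ)
        =ᵐ[volume] f := by
      rw [hF]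
      filter_upwards [hm.coeFn_toLp] with ξ hξ
      have := (sobolevSymbol_pos α ξ).ne'
      rw [hξ, ← mul_assoc, ← Complex.ofReal_mul, mul_inv_cancel₀ this]
      simp
    refine ⟨⟨𝓕⁻ (hm.toLp), (memLp_congr_ae hae).2 (Lp.memLp f)⟩, ?_⟩
    refine Lp.ext ?_
    exact (MemLp.coeFn_toLp ((memLp_congr_ae hae).2 (Lp.memLp f))).trans hae
  exact (completeSpace_congr (e := Equiv.ofBijective _ ⟨hiso.injective, hsurj⟩)
    hiso.isUniformEmbedding).2 inferInstance

/-- Density matrices: `γ(𝐱; 𝐱')` is the complex conjugate of `γ(𝐱'; 𝐱)`, and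
`γ(x_{σ 1}, …, x_{σ k}; x'_{σ 1}, …, x'_{σ k}) = γ(x_1, …, x_k; x'_1, …, x'_k)` for every
permutation `σ`, almost everywhere. -/
def IsSymm {n k : ℕ} {α : ℝ} (γ : Sob n k α) : Prop :=
  (∀ᵐ z : Conf n k, γ.toL2 z = starRingEnd ℂ (γ.toL2 (WithLp.toLp 2 fun p => z (p.1.swap, p.2)))) ∧
  ∀ σ : Equiv.Perm (Fin k), ∀ᵐ z : Conf n k,
    γ.toL2 z = γ.toL2 (WithLp.toLp 2 fun p => z (p.1.map σ σ, p.2))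

theorem memLp_propSymbol_mul {n k : ℕ} (t : ℝ) {f : Conf n k → ℂ} (hf : MemLp f 2 volume) :
    MemLp (fun ξ => propSymbol t ξ * f ξ) 2 volume := by
  refine hf.mono ((continuous_propSymbol t).aestronglyMeasurable.mul hf.1)
    (Filter.Eventually.of_forall fun ξ => ?_)
  rw [norm_mul, norm_propSymbol, one_mul]

/-- The free propagator `exp (i t Δ_±^{(k)})` on `L²`, as a Fourier multiplier. -/
def propL2 {n k : ℕ} (t : ℝ) (γ : L2 n k) : L2 n k :=
  𝓕⁻ (MemLp.toLp _ (memLp_propSymbol_mul t (Lp.memLp (𝓕 γ : L2 n k))))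

theorem fourier_propL2 {n k : ℕ} (t : ℝ) (γ : L2 n k) :
    (𝓕 (propL2 t γ) : L2 n k) =ᵐ[volume] fun ξ => propSymbol t ξ * (𝓕 γ : L2 n k) ξ := by
  have h : (𝓕 (propL2 t γ) : L2 n k)
      = MemLp.toLp _ (memLp_propSymbol_mul t (Lp.memLp (𝓕 γ : L2 n k))) :=
    (Lp.fourierTransformₗᵢ (Conf n k) ℂ).apply_symm_apply _
  rw [h]
  exact MemLp.coeFn_toLp _

/-- The free propagator `exp (i t Δ_±^{(k)})` on `H^α`. -/
def prop {n k : ℕ} {α : ℝ} (t : ℝ) (γ : Sob n k α) : Sob n k α :=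
  ⟨propL2 t γ.toL2, by
    refine (memLp_congr_ae ?_).2 (memLp_propSymbol_mul t γ.memLp)
    filter_upwards [fourier_propL2 t γ.toL2] with ξ hξ
    rw [hξ, Sob.toL2]
    ring⟩

/-- The point `(x_1, …, x_k, y; x'_1, …, x'_k, y)`, where `y` is the variable labelled `i`. -/
def contract {n k : ℕ} (i : Fin k ⊕ Fin k) (z : Conf n k) : Conf n (k + 1) :=
  WithLp.toLp 2 fun p =>
    Sum.elim (Fin.snoc (α := fun _ => ℝ) (fun j => z (Sum.inl j, p.2)) (z (i, p.2)))
      (Fin.snoc (α := fun _ => ℝ) (fun j => z (Sum.inr j, p.2)) (z (i, p.2))) p.1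

/-- `g = B^{(k)} γ`, where `B^{(k)} = ∑_j (B¹_{j,k} - B²_{j,k})`. Integrated against the delta
functions, a continuous `γ` is evaluated at `x_{k+1} = x'_{k+1} = x_j` in `B¹_{j,k}` and at
`x_{k+1} = x'_{k+1} = x'_j` in `B²_{j,k}`. For `α > n/2` every element of `H^α` has a (unique)
continuous representative, to which these evaluations are applied; this is the
extension by continuity of `B^{(k)}` from Schwartz functions. -/
def IsCollision {n k : ℕ} {α : ℝ} (γ : Sob n (k + 1) α) (g : Sob n k α) : Prop :=
  ∃ c : Conf n (k + 1) → ℂ, Continuous c ∧ γ.toL2 =ᵐ[volume] c ∧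
    g.toL2 =ᵐ[volume] fun z => ∑ j, (c (contract (Sum.inl j) z) - c (contract (Sum.inr j) z))

/-- Sequences `Γ = {γ^{(k)}}_{k ≥ 1}` with `γ^{(k)} ∈ H^α(ℝ^{kn} × ℝ^{kn})`; the entry of index
`k : ℕ` is `γ^{(k+1)}`. -/
abbrev Hier (n : ℕ) (α : ℝ) : Type := ∀ k : ℕ, Sob n (k + 1) α

/-- `∑_{k ≥ 1} λ^{-k} a_k < ∞` for some `λ > 0` (the entry of index `k` being `a_{k+1}`). -/
def SeqMem (a : ℕ → ℝ) : Prop :=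
  ∃ l : ℝ, 0 < l ∧ Summable fun k => (l ^ (k + 1))⁻¹ * a k

/-- `(1/2) inf {λ > 0 : ∑_{k ≥ 1} λ^{-k} a_k ≤ 1}`, for nonnegative `a` with `SeqMem a`. -/
def seqNorm (a : ℕ → ℝ) : ℝ :=
  1 / 2 * sInf {l : ℝ | 0 < l ∧ (Summable fun k => (l ^ (k + 1))⁻¹ * a k) ∧
    ∑' k, (l ^ (k + 1))⁻¹ * a k ≤ 1}

/-- `Γ ∈ 𝓗^α`. -/
def MemHier {n : ℕ} {α : ℝ} (Γ : Hier n α) : Prop :=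
  (∀ k, IsSymm (Γ k)) ∧ SeqMem fun k => ‖Γ k‖

/-- The quasi-norm of `𝓗^α`. -/
def hierNorm {n : ℕ} {α : ℝ} (Γ : Hier n α) : ℝ := seqNorm fun k => ‖Γ k‖

/-- The norm of `C([0,T], H^α_k)`. -/
def supNorm {E : Type*} [NormedAddCommGroup E] (T : ℝ) (u : ℝ → E) : ℝ :=
  ⨆ t : Icc (0 : ℝ) T, ‖u t‖

/-- `Γ ∈ C([0,T], 𝓗^α)`: symmetric, each `γ^{(k)}` lies in `C([0,T], H^α_k)`, and
`∑_k λ^{-k} ‖γ^{(k)}‖_{C([0,T], H^α_k)} < ∞` for some `λ > 0`. Only the values `Γ t` with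
`t ∈ [0,T]` matter. -/
def MemCHier {n : ℕ} {α : ℝ} (T : ℝ) (Γ : ℝ → Hier n α) : Prop :=
  (∀ t ∈ Icc 0 T, ∀ k, IsSymm (Γ t k)) ∧ (∀ k, ContinuousOn (fun t => Γ t k) (Icc 0 T)) ∧
    SeqMem fun k => supNorm T fun t => Γ t k

/-- The quasi-norm of `C([0,T], 𝓗^α)`:
`(1/2) inf {λ > 0 : ∑_k λ^{-k} ‖γ^{(k)}‖_{C([0,T], H^α_k)} ≤ 1}`. -/
def cHierNorm {n : ℕ} {α : ℝ} (T : ℝ) (Γ : ℝ → Hier n α) : ℝ :=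
  seqNorm fun k => supNorm T fun t => Γ t k

/-- `Γ ∈ C([0,T], 𝓗^α)` is a (strong) solution on `[0,T]` of the cubic Gross-Pitaevskii hierarchy
with coupling `μ` and initial data `Γ₀`: for every `k` and `t ∈ [0,T]`,
`γ_t^{(k)} = exp(i t Δ_±) γ_0^{(k)} + ∫_0^t exp(i (t-s) Δ_±) (-i μ B^{(k)} γ_s^{(k+1)}) ds`, with a
Bochner integral in `H^α`. -/
def IsSolution {n : ℕ} {α : ℝ} (μ T : ℝ) (Γ₀ : Hier n α) (Γ : ℝ → Hier n α) : Prop :=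
  MemCHier T Γ ∧ ∀ k, ∃ b : ℝ → Sob n (k + 1) α,
    (∀ s ∈ Icc 0 T, IsCollision (Γ s (k + 1)) (b s)) ∧
    ∀ t ∈ Icc 0 T,
      IntervalIntegrable (fun s => prop (t - s) ((-Complex.I * (μ : ℂ)) • b s)) volume 0 t ∧
      Γ t k = prop t (Γ₀ k) + ∫ s in (0 : ℝ)..t, prop (t - s) ((-Complex.I * (μ : ℂ)) • b s)

end GP

end

noncomputable section

namespace GP

/-! The hierarchy is linear and upper triangular: the equation for entry `k` involves only entries
`k` and `k + 1`. The free flow is isometric on each Sobolev space, and the collision operator into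
entry `k` has norm at most `M * (k + 1)`. In the `m`-fold Duhamel integral, the factors
(k+1)...(k+m) meet the 1/m! from the time simplex and leave the binomial coefficient of
`norm_iter_le`. Summing with weights λ^{-k} and regrouping by N = k + m, the binomial theorem gives
powers of 1/λ + MT. Hence λ = 2l is admissible for the series as soon as l is admissible for the
data and 1/(2l) + MT ≤ 1/l, that is 2MlT ≤ 1 (`duhamelBound_spec`, `scale_bound`). This accounts for
the factor 2 in both estimates.

Existence sums the Duhamel series (`exists_solution`). For the stability estimate, the difference of
two solutions is expanded J times. Its remainder is dominated by the J-th term of a convergent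
series built from the a priori size of the difference, so it vanishes as J grows, and the same
majorant bounds the difference by its initial data (`norm_le_of_solution`).

The analytic input is the collision bound. Restricting to x_{k+1} = x'_{k+1} = y, with y one of the
remaining variables, amounts in Fourier space to integrating out two frequencies along a shear
(`fourierInv_contractFourier`). Cauchy-Schwarz reduces boundedness to a uniform bound on an integral
of quotients of weights. The bracket of a sum is controlled by the sum of the brackets, so one
factor cancels and two integrable factors remain; integrability is exactly where α > n/2 enters
(`lintegral_schur_le`).

Symmetry of density matrices is a closed real-linear condition preserved by the free flow and by
-iμB, hence by every Duhamel iterate and by the limit of the series. -/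

/-! ### Weighted sums and the quasi-norm -/

/-- `l` is admissible in the infimum that defines `seqNorm a`. -/
def Admissible (a : ℕ → ℝ) (l : ℝ) : Prop :=
  0 < l ∧ (Summable fun k => (l ^ (k + 1))⁻¹ * a k) ∧ ∑' k, (l ^ (k + 1))⁻¹ * a k ≤ 1

theorem Admissible.of_le {a b : ℕ → ℝ} {l : ℝ} (h : Admissible b l) (ha : ∀ k, 0 ≤ a k)
    (hab : ∀ k, a k ≤ b k) : Admissible a l := by
  obtain ⟨hl, hs, ht⟩ := h
  have hle : ∀ k, (l ^ (k + 1))⁻¹ * a k ≤ (l ^ (k + 1))⁻¹ * b k := fun k =>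
    mul_le_mul_of_nonneg_left (hab k) (by positivity)
  have hs' : Summable fun k => (l ^ (k + 1))⁻¹ * a k :=
    Summable.of_nonneg_of_le (fun k => mul_nonneg (by positivity) (ha k)) hle hs
  exact ⟨hl, hs', (hs'.tsum_le_tsum hle hs).trans ht⟩

theorem Admissible.seqMem {a : ℕ → ℝ} {l : ℝ} (h : Admissible a l) : SeqMem a :=
  ⟨l, h.1, h.2.1⟩

theorem Admissible.seqNorm_le {a : ℕ → ℝ} {l : ℝ} (h : Admissible a l) : seqNorm a ≤ l / 2 := by
  have : sInf {l : ℝ | 0 < l ∧ (Summable fun k => (l ^ (k + 1))⁻¹ * a k) ∧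
    ∑' k, (l ^ (k + 1))⁻¹ * a k ≤ 1} ≤ l := csInf_le ⟨0, fun x hx => hx.1.le⟩ h
  unfold seqNorm
  linarith

theorem summable_seq_of_le {a : ℕ → ℝ} (ha : ∀ k, 0 ≤ a k) {l l' : ℝ} (hl : 0 < l) (hll : l ≤ l')
    (h : Summable fun k => (l ^ (k + 1))⁻¹ * a k) : Summable fun k => (l' ^ (k + 1))⁻¹ * a k :=
  Summable.of_nonneg_of_le
    (fun k => mul_nonneg (inv_nonneg.2 (pow_nonneg (hl.le.trans hll) _)) (ha k))
    (fun k => mul_le_mul_of_nonneg_right (by gcongr) (ha k)) h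

theorem SeqMem.exists_admissible {a : ℕ → ℝ} (ha : ∀ k, 0 ≤ a k) (h : SeqMem a) :
    ∃ l, Admissible a l := by
  obtain ⟨l, hl, hs⟩ := h
  set S := ∑' k, (l ^ (k + 1))⁻¹ * a k with hS
  -- Every exponent is at least 1, so enlarging `l` by the factor `K ≥ 1` divides the whole sum by
  -- at least `K`.
  set K := max 1 S with hK
  have hK1 : 1 ≤ K := le_max_left _ _
  have hK0 : 0 < K := by linarith
  have hle : ∀ k, ((l * K) ^ (k + 1))⁻¹ * a k ≤ K⁻¹ * ((l ^ (k + 1))⁻¹ * a k) := by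
    intro k
    rw [mul_pow, mul_inv, mul_comm (l ^ (k + 1))⁻¹, mul_assoc]
    refine mul_le_mul_of_nonneg_right ?_ (mul_nonneg (by positivity) (ha k))
    exact inv_anti₀ hK0 (le_self_pow₀ hK1 (by omega))
  have hs' := Summable.of_nonneg_of_le (fun k => mul_nonneg (by positivity) (ha k)) hle
    (hs.mul_left K⁻¹)
  refine ⟨l * K, by positivity, hs', (hs'.tsum_le_tsum hle (hs.mul_left _)).trans ?_⟩
  rw [tsum_mul_left, ← hS, inv_mul_le_iff₀ hK0, mul_one]
  exact le_max_right _ _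

theorem SeqMem.add {a b : ℕ → ℝ} (ha : ∀ k, 0 ≤ a k) (hb : ∀ k, 0 ≤ b k) (h : SeqMem a)
    (h' : SeqMem b) : SeqMem fun k => a k + b k := by
  obtain ⟨l, hl, hs⟩ := h
  obtain ⟨l', hl', hs'⟩ := h'
  refine ⟨max l l', lt_max_of_lt_left hl, ?_⟩
  simp_rw [mul_add]
  exact (summable_seq_of_le ha hl (le_max_left _ _) hs).add
    (summable_seq_of_le hb hl' (le_max_right _ _) hs')

theorem SeqMem.of_le {a b : ℕ → ℝ} (h : SeqMem b) (ha : ∀ k, 0 ≤ a k) (hab : ∀ k, a k ≤ b k) :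
    SeqMem a := by
  obtain ⟨l, hl, hs⟩ := h
  exact ⟨l, hl, Summable.of_nonneg_of_le (fun k => mul_nonneg (by positivity) (ha k))
    (fun k => mul_le_mul_of_nonneg_left (hab k) (by positivity)) hs⟩

theorem seqNorm_mono {a b : ℕ → ℝ} (hb : SeqMem b) (ha : ∀ k, 0 ≤ a k) (hab : ∀ k, a k ≤ b k) :
    seqNorm a ≤ seqNorm b := by
  have hb0 : ∀ k, 0 ≤ b k := fun k => (ha k).trans (hab k)
  refine mul_le_mul_of_nonneg_left ?_ (by norm_num)
  exact csInf_le_csInf ⟨0, fun x hx => hx.1.le⟩ (hb.exists_admissible hb0)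
    fun l hl => Admissible.of_le hl ha hab

theorem exists_admissible_near {a : ℕ → ℝ} (ha : ∀ k, 0 ≤ a k) (h : SeqMem a) {ε : ℝ}
    (hε : 0 < ε) : ∃ l, Admissible a l ∧ l < 2 * seqNorm a + ε := by
  obtain ⟨l, hl, hlt⟩ := exists_lt_of_csInf_lt (h.exists_admissible ha)
    (lt_add_of_pos_right (sInf {l | Admissible a l}) hε)
  refine ⟨l, hl, hlt.trans_eq ?_⟩
  change _ = 2 * (1 / 2 * sInf {l | Admissible a l}) + ε
  ring

/-- If `8 M ‖a‖ T ≤ 1`, then admissible values with `2 M l T ≤ 1` exist arbitrarily close to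
`2 ‖a‖`. -/
theorem exists_admissible_le {a : ℕ → ℝ} (ha : ∀ k, 0 ≤ a k) (h : SeqMem a) {M T : ℝ}
    (hM : 0 < M) (hT : 0 < T) (hMT : 4 * (2 * M) * seqNorm a * T ≤ 1) {ε : ℝ} (hε : 0 < ε) :
    ∃ l, Admissible a l ∧ 2 * M * l * T ≤ 1 ∧ l ≤ 2 * seqNorm a + ε := by
  -- The hypothesis makes the infimum contribute at most 1/2 to `2 * M * l * T`; an excess below `1
  -- / (4 * M * T)` contributes at most the other half.
  obtain ⟨l, hl, hlt⟩ := exists_admissible_near ha h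
    (lt_min hε (by positivity : 0 < 1 / (4 * M * T)))
  refine ⟨l, hl, ?_, hlt.le.trans (by gcongr; exact min_le_left _ _)⟩
  have h1 : l ≤ 2 * seqNorm a + 1 / (4 * M * T) :=
    hlt.le.trans (by gcongr; exact min_le_right _ _)
  have h2 := mul_le_mul_of_nonneg_left h1 (by positivity : 0 ≤ 2 * M * T)
  have h3 : 2 * M * T * (1 / (4 * M * T)) = 1 / 2 := by field_simp; norm_num
  rw [mul_add, h3] at h2
  linarith

/-- The infimum need not be attained, so the passage from `l` to `2 * l` is made for admissible `l`
tending to it. -/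
theorem seqNorm_le_two_mul {a c : ℕ → ℝ} (ha : ∀ k, 0 ≤ a k) (h : SeqMem a) {M T : ℝ}
    (hM : 0 < M) (hT : 0 < T) (hMT : 4 * (2 * M) * seqNorm a * T ≤ 1)
    (hc : ∀ l, Admissible a l → 2 * M * l * T ≤ 1 → Admissible c (2 * l)) :
    seqNorm c ≤ 2 * seqNorm a := by
  refine le_of_forall_pos_le_add fun ε hε => ?_
  obtain ⟨l, hl, hl1, hl2⟩ := exists_admissible_le ha h hM hT hMT hε
  have := (hc l hl hl1).seqNorm_le
  linarith

/-! ### The binomial majorant of the Duhamel series -/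

/-- The bound `∑_m (k+m choose m) θ^m a_{k+m}` of the `k`-th entry of the Duhamel series. -/
def duhamelBound (a : ℕ → ℝ) (θ : ℝ) (k : ℕ) : ℝ :=
  ∑' m, ((k + m).choose m : ℝ) * θ ^ m * a (k + m)

/-- All terms are nonnegative, so the double sum over (k, m) may be regrouped along k + m = N. By
the binomial theorem each antidiagonal contributes l'⁻¹ (l'⁻¹ + θ)^N a_N, which is at most the N-th
term of the original sum. -/
theorem duhamelBound_spec {a : ℕ → ℝ} (ha : ∀ k, 0 ≤ a k) {l l' θ : ℝ} (h : Admissible a l)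
    (hθ : 0 ≤ θ) (hl' : 0 < l') (hle : l'⁻¹ + θ ≤ l⁻¹) :
    (∀ k, Summable fun m => ((k + m).choose m : ℝ) * θ ^ m * a (k + m)) ∧
      Admissible (duhamelBound a θ) l' := by
  obtain ⟨hl, hs, ht⟩ := h
  set f : ℕ × ℕ → ℝ := fun p =>
    (l' ^ (p.1 + 1))⁻¹ * (((p.1 + p.2).choose p.2 : ℝ) * θ ^ p.2 * a (p.1 + p.2)) with hf
  have hf0 : ∀ p, 0 ≤ f p := fun p => by
    have := ha (p.1 + p.2)
    simp only [hf]
    positivity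
  set e := Finset.HasAntidiagonal.sigmaAntidiagonalEquivProd (A := ℕ)
  have hsum : ∀ N, ∑' p : Finset.HasAntidiagonal.antidiagonal N, f (e ⟨N, p⟩) ≤ (l ^ (N + 1))⁻¹ * a N := by
    intro N
    rw [tsum_fintype]
    have h1 : ∑ p : Finset.HasAntidiagonal.antidiagonal N, f (e ⟨N, p⟩) =
        ∑ p ∈ Finset.HasAntidiagonal.antidiagonal N, f p :=
      Finset.sum_coe_sort (Finset.HasAntidiagonal.antidiagonal N) f
    have h2 : ∑ p ∈ Finset.HasAntidiagonal.antidiagonal N, f p = l'⁻¹ * (l'⁻¹ + θ) ^ N * a N := by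
      rw [(Commute.all _ _).add_pow', Finset.mul_sum, Finset.sum_mul]
      refine Finset.sum_congr rfl fun p hp => ?_
      rw [Finset.HasAntidiagonal.mem_antidiagonal] at hp
      simp only [hf, hp]
      rw [Nat.choose_symm_of_eq_add hp.symm, nsmul_eq_mul, inv_pow, pow_succ, mul_inv]
      ring
    rw [h1, h2]
    refine mul_le_mul_of_nonneg_right ?_ (ha N)
    rw [← inv_pow, pow_succ' (l⁻¹)]
    have hl0 : 0 ≤ l'⁻¹ := by positivity
    exact mul_le_mul (by linarith) (pow_le_pow_left₀ (by positivity) hle _) (by positivity)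
      (by positivity)
  have hse : Summable fun q => f (e q) := by
    refine (summable_sigma_of_nonneg fun q => hf0 _).2 ⟨fun N => Summable.of_finite, ?_⟩
    exact Summable.of_nonneg_of_le (fun N => tsum_nonneg fun p => hf0 _) hsum hs
  have hsf : Summable f := e.summable_iff.1 hse
  have hk := hsf.prod_factor
  refine ⟨fun k => (summable_mul_left_iff (by positivity : (l' ^ (k + 1))⁻¹ ≠ 0)).1 (hk k), hl',
    ?_, ?_⟩
  · simpa only [hf, duhamelBound, tsum_mul_left] using hsf.prod
  · have h1 : ∑' k, (l' ^ (k + 1))⁻¹ * duhamelBound a θ k = ∑' p, f p := by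
      rw [hsf.tsum_prod]
      simp only [hf, duhamelBound, tsum_mul_left]
    rw [h1, ← e.tsum_eq f, hse.tsum_sigma]
    exact ((hse.sigma).tsum_le_tsum hsum hs).trans ht

/-- A closed subspace of a complete space is complete, so the integral can be formed inside it and
then pushed forward by the inclusion. This keeps Duhamel integrals symmetric. -/
theorem intervalIntegral_mem_of_isClosed {F : Type*} [NormedAddCommGroup F] [NormedSpace ℝ F]
    [CompleteSpace F] {V : Submodule ℝ F} (hV : IsClosed (V : Set F)) {u : ℝ → F}
    (hu : Continuous u) (huV : ∀ t, u t ∈ V) (a b : ℝ) : ∫ t in a..b, u t ∈ V := by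
  have : CompleteSpace V := hV.completeSpace_coe
  set g : ℝ → V := fun t => ⟨u t, huV t⟩ with hg
  have hgc : Continuous g := hu.subtype_mk _
  have h := V.subtypeL.intervalIntegral_comp_comm (hgc.intervalIntegrable (μ := volume) a b)
  change ∫ t in a..b, V.subtypeL (g t) ∈ V
  rw [h]
  exact Subtype.coe_prop _

/-! ### Abstract linear hierarchies -/

/-- A linear hierarchy `u_k' = A_k u_k + B_k u_{k+1}` of evolution equations, where `A_k` generates
the isometric group `S_k` and the norm of `B_k` grows at most linearly in `k`. -/
structure LinearHierarchy (E : ℕ → Type*) [∀ k, NormedAddCommGroup (E k)]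
    [∀ k, NormedSpace ℝ (E k)] where
  S : ∀ k, ℝ → E k →L[ℝ] E k
  B : ∀ k, E (k + 1) →L[ℝ] E k
  M : ℝ
  S_zero : ∀ k x, S k 0 x = x
  S_add : ∀ k s t x, S k (s + t) x = S k s (S k t x)
  norm_S : ∀ k t x, ‖S k t x‖ = ‖x‖
  continuous_S : ∀ k x, Continuous fun t => S k t x
  M_pos : 0 < M
  norm_B : ∀ k x, ‖B k x‖ ≤ M * (k + 1) * ‖x‖

namespace LinearHierarchy

variable {E : ℕ → Type*} [∀ k, NormedAddCommGroup (E k)] [∀ k, NormedSpace ℝ (E k)]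
  (H : LinearHierarchy E)

/-- Strong continuity handles the moving time; the isometry property handles the moving vector
uniformly in time. -/
theorem continuous_S_apply (k : ℕ) {f : ℝ → ℝ} (hf : Continuous f) {u : ℝ → E k}
    (hu : Continuous u) : Continuous fun t => H.S k (f t) (u t) := by
  refine continuous_iff_continuousAt.2 fun t₀ => ?_
  have h1 : Filter.Tendsto (fun t => H.S k (f t) (u t₀)) (nhds t₀) (nhds (H.S k (f t₀) (u t₀))) :=
    ((H.continuous_S k (u t₀)).comp hf).tendsto t₀
  have h2 : Filter.Tendsto (fun t => H.S k (f t) (u t - u t₀)) (nhds t₀) (nhds 0) := by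
    rw [tendsto_zero_iff_norm_tendsto_zero]
    simp_rw [H.norm_S]
    have := (hu.sub continuous_const : Continuous fun t => u t - u t₀).norm.tendsto t₀
    simpa using this
  have h3 := h1.add h2
  simpa [ContinuousAt] using h3

/-- The Duhamel integral `∫_0^t S_k(t-s) B_k u(s) ds`. -/
def duhamel (k : ℕ) (u : ℝ → E (k + 1)) (t : ℝ) : E k :=
  ∫ s in (0 : ℝ)..t, H.S k (t - s) (H.B k (u s))

theorem continuous_duhamel_integrand (k : ℕ) {u : ℝ → E (k + 1)} (hu : Continuous u) (t : ℝ) :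
    Continuous fun s => H.S k (t - s) (H.B k (u s)) :=
  H.continuous_S_apply k (by fun_prop) (by fun_prop)

/-- The group law removes `t` from the integrand, so continuity in `t` follows from that of a
primitive. -/
theorem duhamel_eq [∀ k, CompleteSpace (E k)] (k : ℕ) {u : ℝ → E (k + 1)} (hu : Continuous u)
    (t : ℝ) : H.duhamel k u t = H.S k t (∫ s in (0 : ℝ)..t, H.S k (-s) (H.B k (u s))) := by
  have hc : Continuous fun s => H.S k (-s) (H.B k (u s)) :=
    H.continuous_S_apply k (by fun_prop) (by fun_prop)
  rw [← ContinuousLinearMap.intervalIntegral_comp_comm _ (hc.intervalIntegrable 0 t)]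
  simp only [duhamel, ← H.S_add, sub_eq_add_neg]

theorem continuous_duhamel [∀ k, CompleteSpace (E k)] (k : ℕ) {u : ℝ → E (k + 1)}
    (hu : Continuous u) : Continuous (H.duhamel k u) := by
  have hc : Continuous fun s => H.S k (-s) (H.B k (u s)) :=
    H.continuous_S_apply k (by fun_prop) (by fun_prop)
  rw [funext (H.duhamel_eq k hu)]
  exact H.continuous_S_apply k continuous_id
    (intervalIntegral.continuous_primitive (fun a b => hc.intervalIntegrable a b) 0)

theorem norm_duhamel_le (k m : ℕ) {u : ℝ → E (k + 1)} {T K : ℝ}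
    (hK : ∀ s ∈ Icc 0 T, ‖u s‖ ≤ K * s ^ m) {t : ℝ} (ht : t ∈ Icc 0 T) :
    ‖H.duhamel k u t‖ ≤ H.M * (k + 1) * K * (t ^ (m + 1) / (m + 1)) := by
  have h1 : ‖H.duhamel k u t‖ ≤ ∫ s in (0 : ℝ)..t, H.M * (k + 1) * K * s ^ m := by
    refine intervalIntegral.norm_integral_le_of_norm_le ht.1 ?_
      (by fun_prop : Continuous fun s : ℝ => H.M * (k + 1) * K * s ^ m).continuousOn.intervalIntegrable
    refine Filter.Eventually.of_forall fun s hs => ?_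
    rw [H.norm_S]
    refine (H.norm_B k _).trans ?_
    rw [mul_assoc _ K]
    have := H.M_pos
    gcongr
    exact hK s ⟨hs.1.le, hs.2.trans ht.2⟩
  refine h1.trans_eq ?_
  rw [intervalIntegral.integral_const_mul, integral_pow]
  simp

theorem duhamel_add (k : ℕ) {u v : ℝ → E (k + 1)} (hu : Continuous u) (hv : Continuous v)
    (t : ℝ) : H.duhamel k (fun s => u s + v s) t = H.duhamel k u t + H.duhamel k v t := by
  simp only [duhamel, map_add]
  exact intervalIntegral.integral_add
    ((H.continuous_duhamel_integrand k hu t).intervalIntegrable 0 t)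
    ((H.continuous_duhamel_integrand k hv t).intervalIntegrable 0 t)

theorem duhamel_congr (k : ℕ) {u v : ℝ → E (k + 1)} {T : ℝ} (h : ∀ s ∈ Icc 0 T, u s = v s)
    {t : ℝ} (ht : t ∈ Icc 0 T) : H.duhamel k u t = H.duhamel k v t := by
  refine intervalIntegral.integral_congr fun s hs => ?_
  rw [uIcc_of_le ht.1] at hs
  simp only [h s ⟨hs.1, hs.2.trans ht.2⟩]

/-- Iterated Duhamel integrals. -/
def iter (u : ∀ k, ℝ → E k) : ℕ → ∀ k, ℝ → E k
  | 0 => u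
  | m + 1 => fun k => H.duhamel k (iter u m (k + 1))

theorem continuous_iter [∀ k, CompleteSpace (E k)] {u : ∀ k, ℝ → E k}
    (hu : ∀ k, Continuous (u k)) (m k : ℕ) : Continuous (H.iter u m k) := by
  induction m generalizing k with
  | zero => exact hu k
  | succ m ih => exact H.continuous_duhamel k (ih (k + 1))

/-- Each step multiplies by `M * (k + 1)` and integrates `s ^ m`, which divides by `m + 1`; the
identity `hch` turns this quotient into the next binomial coefficient. -/
theorem norm_iter_le {u : ∀ k, ℝ → E k} {T : ℝ} {b : ℕ → ℝ}
    (hb : ∀ k, ∀ t ∈ Icc 0 T, ‖u k t‖ ≤ b k) (m k : ℕ) {t : ℝ} (ht : t ∈ Icc 0 T) :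
    ‖H.iter u m k t‖ ≤ ((k + m).choose m * H.M ^ m * b (k + m)) * t ^ m := by
  induction m generalizing k t with
  | zero => simpa [iter] using hb k t ht
  | succ m ih =>
    refine (H.norm_duhamel_le k m (fun s hs => ih (k + 1) hs) ht).trans_eq ?_
    have e : k + 1 + m = k + (m + 1) := by ring
    have hch : ((k + (m + 1)).choose (m + 1) : ℝ) * (m + 1) = (k + (m + 1)).choose m * (k + 1) := by
      have := Nat.choose_succ_right_eq (k + (m + 1)) m
      rw [show k + (m + 1) - m = k + 1 by omega] at this
      exact_mod_cast this
    rw [e, pow_succ H.M]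
    field_simp
    linear_combination (-(H.M * b (k + (m + 1)) * H.M ^ m * t ^ (m + 1))) * hch

theorem norm_iter_le_sup {u : ∀ k, ℝ → E k} {T : ℝ} {b : ℕ → ℝ} (hb0 : ∀ k, 0 ≤ b k)
    (hb : ∀ k, ∀ t ∈ Icc 0 T, ‖u k t‖ ≤ b k) (m k : ℕ) {t : ℝ} (ht : t ∈ Icc 0 T) :
    ‖H.iter u m k t‖ ≤ (k + m).choose m * (H.M * T) ^ m * b (k + m) := by
  refine (H.norm_iter_le hb m k ht).trans ?_
  have h1 : t ^ m ≤ T ^ m := pow_le_pow_left₀ ht.1 ht.2 m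
  have := H.M_pos
  have := hb0 (k + m)
  calc _ ≤ ((k + m).choose m * H.M ^ m * b (k + m)) * T ^ m := by gcongr
    _ = _ := by rw [mul_pow]; ring

theorem iter_add [∀ k, CompleteSpace (E k)] {u v : ∀ k, ℝ → E k} (hu : ∀ k, Continuous (u k))
    (hv : ∀ k, Continuous (v k)) (m k : ℕ) (t : ℝ) :
    H.iter (fun k t => u k t + v k t) m k t = H.iter u m k t + H.iter v m k t := by
  induction m generalizing k t with
  | zero => rfl
  | succ m ih =>
    change H.duhamel k _ t = H.duhamel k _ t + H.duhamel k _ t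
    rw [← H.duhamel_add k (H.continuous_iter hu m _) (H.continuous_iter hv m _)]
    exact congrArg (fun w => H.duhamel k w t) (funext fun s => ih (k + 1) s)

theorem iter_congr {u v : ∀ k, ℝ → E k} {T : ℝ} (h : ∀ k, ∀ s ∈ Icc 0 T, u k s = v k s)
    (m k : ℕ) {t : ℝ} (ht : t ∈ Icc 0 T) : H.iter u m k t = H.iter v m k t := by
  induction m generalizing k t with
  | zero => exact h k t ht
  | succ m ih => exact H.duhamel_congr k (fun s hs => ih (k + 1) hs) ht

theorem iter_iter_one (u : ∀ k, ℝ → E k) (m : ℕ) : H.iter (H.iter u 1) m = H.iter u (m + 1) := by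
  induction m with
  | zero => rfl
  | succ m ih => exact funext fun k => congrArg (fun w : ∀ k, ℝ → E k => H.duhamel k (w (k + 1))) ih

/-- The free evolution of the initial data `x`. -/
def free (x : ∀ k, E k) (k : ℕ) (t : ℝ) : E k := H.S k t (x k)

/-- The equation is substituted into its own last term `J` times. -/
theorem eq_sum_add_iter [∀ k, CompleteSpace (E k)] {x : ∀ k, E k} {u : ∀ k, ℝ → E k} {T : ℝ}
    (hu : ∀ k, Continuous (u k))
    (h : ∀ k, ∀ t ∈ Icc 0 T, u k t = H.free x k t + H.duhamel k (u (k + 1)) t) (J k : ℕ) {t : ℝ}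
    (ht : t ∈ Icc 0 T) :
    u k t = ∑ m ∈ Finset.range J, H.iter (H.free x) m k t + H.iter u J k t := by
  induction J with
  | zero => simp [iter]
  | succ J ih =>
    have h1 : H.iter u J k t = H.iter (H.free x) J k t + H.iter u (J + 1) k t := by
      rw [← H.iter_iter_one, ← H.iter_add (u := H.free x) (fun k => H.continuous_S k (x k))
        (H.continuous_iter hu 1)]
      exact H.iter_congr h J k ht
    rw [Finset.sum_range_succ, add_assoc, ← h1]
    exact ih

theorem scale_bound {T l : ℝ} (hl : 0 < l) (h : 2 * H.M * l * T ≤ 1) :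
    (2 * l)⁻¹ + H.M * T ≤ l⁻¹ := by
  rw [mul_inv, ← le_sub_iff_add_le']
  have : l⁻¹ - 2⁻¹ * l⁻¹ = 1 / (2 * l) := by field_simp; norm_num
  rw [this, le_div_iff₀ (by positivity)]
  linarith

/-- Existence: the Duhamel series converges. -/
theorem exists_solution [∀ k, CompleteSpace (E k)] (x : ∀ k, E k) {T : ℝ} (hT : 0 < T) {l₀ : ℝ}
    (hl₀ : Admissible (fun k => ‖x k‖) l₀) (hlT₀ : 2 * H.M * l₀ * T ≤ 1)
    (V : ∀ k, Submodule ℝ (E k)) (hV : ∀ k, IsClosed (V k : Set (E k)))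
    (hSV : ∀ k t, ∀ y ∈ V k, H.S k t y ∈ V k) (hBV : ∀ k, ∀ y ∈ V (k + 1), H.B k y ∈ V k)
    (hx : ∀ k, x k ∈ V k) :
    ∃ u : ∀ k, ℝ → E k, (∀ k, Continuous (u k)) ∧ (∀ k t, u k t ∈ V k) ∧
      (∀ k, ∀ t ∈ Icc 0 T, u k t = H.free x k t + H.duhamel k (u (k + 1)) t) ∧
      ∀ k, ∀ t, ‖u k t‖ ≤ duhamelBound (fun k => ‖x k‖) (H.M * T) k := by
  have hMT : 0 ≤ H.M * T := (mul_pos H.M_pos hT).le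
  have hsum := (duhamelBound_spec (fun k => norm_nonneg (x k)) hl₀ hMT
    (mul_pos two_pos hl₀.1) (H.scale_bound hl₀.1 hlT₀)).1
  have hfc : ∀ k, Continuous (H.free x k) := fun k => H.continuous_S k (x k)
  have hbound : ∀ m k, ∀ t ∈ Icc 0 T, ‖H.iter (H.free x) m k t‖ ≤
      (k + m).choose m * (H.M * T) ^ m * ‖x (k + m)‖ := fun m k t ht =>
    H.norm_iter_le_sup (b := fun k => ‖x k‖) (fun k => norm_nonneg _)
      (fun k t _ => (H.norm_S k t _).le) m k ht
  have hmem : ∀ m k t, H.iter (H.free x) m k t ∈ V k := by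
    intro m
    induction m with
    | zero => exact fun k t => hSV k t _ (hx k)
    | succ m ih =>
      intro k t
      exact intervalIntegral_mem_of_isClosed (hV k)
        (H.continuous_duhamel_integrand k (H.continuous_iter hfc m _) t)
        (fun s => hSV k _ _ (hBV k _ (ih _ _))) 0 t
  -- The series is controlled only on `[0, T]`; clamping time extends its sum to a continuous
  -- function on the whole line.
  set p : ℝ → ℝ := fun t => (projIcc 0 T hT.le t : ℝ) with hp
  have hpm : ∀ t, p t ∈ Icc 0 T := fun t => Subtype.coe_prop _
  have hpe : ∀ t ∈ Icc 0 T, p t = t := fun t ht => by simp only [hp, projIcc_of_mem hT.le ht]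
  have hpc : Continuous p := continuous_subtype_val.comp continuous_projIcc
  have hs : ∀ k, ∀ t ∈ Icc 0 T, Summable fun m => H.iter (H.free x) m k t := fun k t ht =>
    Summable.of_norm_bounded (hsum k) fun m => hbound m k t ht
  refine ⟨fun k t => ∑' m, H.iter (H.free x) m k (p t), fun k => ?_, fun k t => ?_,
    fun k t ht => ?_, fun k t => ?_⟩
  · exact continuous_tsum (fun m => (H.continuous_iter hfc m k).comp hpc) (hsum k)
      fun m t => hbound m k _ (hpm t)
  · refine (hV k).mem_of_tendsto (hs k _ (hpm t)).hasSum (Filter.Eventually.of_forall fun F => ?_)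
    exact Submodule.sum_mem _ fun m _ => hmem m k _
  · have hint : HasSum (fun m => H.duhamel k (H.iter (H.free x) m (k + 1)) t)
        (H.duhamel k (fun t => ∑' m, H.iter (H.free x) m (k + 1) (p t)) t) := by
      -- Termwise integration: the Duhamel integral of the sum is the sum shifted by one index,
      -- whose missing zeroth term is the free evolution.
      refine intervalIntegral.hasSum_integral_of_dominated_convergence
        (fun m _ => H.M * (k + 1) *
          (((k + 1 + m).choose m : ℝ) * (H.M * T) ^ m * ‖x (k + 1 + m)‖)) ?_ ?_ ?_ ?_ ?_
      · exact fun m => (H.continuous_duhamel_integrand k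
          (H.continuous_iter hfc m _) t).aestronglyMeasurable
      · refine fun m => Filter.Eventually.of_forall fun s hs => ?_
        rw [uIoc_of_le ht.1] at hs
        rw [H.norm_S]
        refine (H.norm_B k _).trans ?_
        have := H.M_pos
        gcongr
        exact hbound m (k + 1) s ⟨hs.1.le, hs.2.trans ht.2⟩
      · exact Filter.Eventually.of_forall fun s _ => (hsum (k + 1)).mul_left _
      · exact intervalIntegrable_const
      · refine Filter.Eventually.of_forall fun s hs' => ?_
        rw [uIoc_of_le ht.1] at hs'
        have hsT : s ∈ Icc 0 T := ⟨hs'.1.le, hs'.2.trans ht.2⟩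
        have := (hs (k + 1) (p s) (hpm s)).hasSum.mapL ((H.S k (t - s)).comp (H.B k))
        simpa only [hpe s hsT, ContinuousLinearMap.comp_apply] using this
    simp only [hpe t ht]
    rw [(hs k t ht).tsum_eq_zero_add, ← hint.tsum_eq]
    rfl
  · exact tsum_of_norm_bounded (hsum k).hasSum fun m => hbound m k _ (hpm t)

/-- Continuous dependence on the initial data. -/
theorem norm_le_of_solution [∀ k, CompleteSpace (E k)] {x : ∀ k, E k} {u : ∀ k, ℝ → E k} {T : ℝ}
    (hT : 0 < T) (hu : ∀ k, Continuous (u k))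
    (h : ∀ k, ∀ t ∈ Icc 0 T, u k t = H.free x k t + H.duhamel k (u (k + 1)) t)
    {b : ℕ → ℝ} (hb0 : ∀ k, 0 ≤ b k) (hb : ∀ k, ∀ t ∈ Icc 0 T, ‖u k t‖ ≤ b k)
    {l₁ : ℝ} (hl₁ : Admissible b l₁) (hlT₁ : 2 * H.M * l₁ * T ≤ 1) (k : ℕ) {t : ℝ}
    (ht : t ∈ Icc 0 T) : ‖u k t‖ ≤ duhamelBound (fun k => ‖x k‖) (H.M * T) k := by
  have hMT : 0 ≤ H.M * T := (mul_pos H.M_pos hT).le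
  have hsb := (duhamelBound_spec hb0 hl₁ hMT
    (mul_pos two_pos hl₁.1) (H.scale_bound hl₁.1 hlT₁)).1 k
  have hx0 : ∀ k, u k 0 = x k := fun k => by
    rw [h k 0 ⟨le_rfl, hT.le⟩]
    simp [free, duhamel, H.S_zero]
  have hxb : ∀ k, ‖x k‖ ≤ b k := fun k => hx0 k ▸ hb k 0 ⟨le_rfl, hT.le⟩
  have hsx : Summable fun m => ((k + m).choose m : ℝ) * (H.M * T) ^ m * ‖x (k + m)‖ :=
    Summable.of_nonneg_of_le (fun m => by positivity)
      (fun m => mul_le_mul_of_nonneg_left (hxb _) (by positivity)) hsb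
  -- The remainder bound is the general term of the summable series `hsb`, hence tends to 0.
  have hlim := hsx.hasSum.tendsto_sum_nat.add hsb.tendsto_atTop_zero
  rw [add_zero] at hlim
  refine ge_of_tendsto' hlim fun J => ?_
  rw [H.eq_sum_add_iter hu h J k ht]
  refine (norm_add_le _ _).trans (add_le_add ((norm_sum_le _ _).trans ?_)
    (H.norm_iter_le_sup hb0 hb J k ht))
  exact Finset.sum_le_sum fun m _ => H.norm_iter_le_sup (b := fun k => ‖x k‖)
    (fun k => norm_nonneg _) (fun k t _ => (H.norm_S k t _).le) m k ht

end LinearHierarchy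

/-! ### Inverse Fourier transform of integrable L² functions -/

section Fourier

variable {V : Type*} [NormedAddCommGroup V] [InnerProductSpace ℝ V] [FiniteDimensional ℝ V]
  [MeasurableSpace V] [BorelSpace V]

theorem integral_fourierInv_smul_eq {f g : V → ℂ} (hf : Integrable f) (hg : Integrable g) :
    ∫ x, 𝓕⁻ f x • g x = ∫ x, f x • 𝓕⁻ g x := by
  have h := VectorFourier.integral_fourierIntegral_smul_eq_flip (L := -innerₗ V)
    (μ := volume) (ν := volume) Real.continuous_fourierChar
    (continuous_inner (𝕜 := ℝ) (E := V)).neg hf hg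
  have e : (-innerₗ V).flip = -innerₗ V := by
    ext x y
    simp [real_inner_comm]
  rw [e] at h
  exact h

/-- The `L²` inverse Fourier transform of an integrable function is given by the integral. -/
theorem coeFn_fourierInv_ae_eq (F : Lp ℂ 2 (volume : Measure V)) (hF : Integrable F) :
    ((𝓕⁻ F : Lp ℂ 2 (volume : Measure V)) : V → ℂ) =ᵐ[volume] 𝓕⁻ (F : V → ℂ) := by
  have hcont : Continuous (𝓕⁻ (F : V → ℂ)) := by
    rw [← Real.Lp.fourierTransformInv_toLp (memLp_one_iff_integrable.2 hF)]
    exact BoundedContinuousFunction.continuous _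
  -- Two locally integrable functions agree almost everywhere if they agree against smooth compactly
  -- supported tests. For such tests the L² transform is computed by duality on tempered
  -- distributions, the pointwise one by Fubini.
  refine ae_eq_of_integral_contDiff_smul_eq
    ((Lp.memLp _).locallyIntegrable one_le_two) hcont.locallyIntegrable fun g hg hgc => ?_
  have hg₁ : HasCompactSupport (Complex.ofRealCLM ∘ g) := hgc.comp_left rfl
  have hg₂ := Complex.ofRealCLM.contDiff.comp hg
  set G := hg₁.toSchwartzMap hg₂ with hG
  have hGx : ∀ x, G x = (g x : ℂ) := fun x => rfl
  have h1 : ∫ x, g x • (𝓕⁻ F : Lp ℂ 2 (volume : Measure V)) x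
      = Lp.toTemperedDistribution (𝓕⁻ F : Lp ℂ 2 (volume : Measure V)) G := by
    rw [Lp.toTemperedDistribution_apply]
    rfl
  rw [h1, ← Lp.fourierInv_toTemperedDistribution_eq, TemperedDistribution.fourierInv_apply,
    Lp.toTemperedDistribution_apply, SchwartzMap.fourierInv_coe,
    integral_fourierInv_smul_eq G.integrable hF]
  rfl

theorem continuous_fourierInv_of_integrable {f : V → ℂ} (hf : Integrable f) :
    Continuous (𝓕⁻ f) := by
  rw [← Real.Lp.fourierTransformInv_toLp (memLp_one_iff_integrable.2 hf)]
  exact BoundedContinuousFunction.continuous _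

end Fourier

/-! ### Configurations, contraction and the dual shear -/

section Geometry

variable {n k : ℕ}

/-- The one-particle space. -/
abbrev Pt (n : ℕ) : Type := EuclideanSpace ℝ (Fin n)

/-- The variable of the particle labelled `i`. -/
def part (ξ : Conf n k) (i : Fin k ⊕ Fin k) : Pt n := WithLp.toLp 2 fun a => ξ (i, a)

/-- The configuration in which the particle labelled `i` is at `y` and all others are at `0`. -/
def single (i : Fin k ⊕ Fin k) (y : Pt n) : Conf n k :=
  WithLp.toLp 2 fun p => if p.1 = i then y p.2 else 0

/-- Adjoin the particles `x_{k+1} = y` and `x'_{k+1} = y'`. -/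
def extend (ξ : Conf n k) (y y' : Pt n) : Conf n (k + 1) :=
  WithLp.toLp 2 fun p =>
    Sum.elim (Fin.snoc (α := fun _ => ℝ) (fun j => ξ (Sum.inl j, p.2)) (y p.2))
      (Fin.snoc (α := fun _ => ℝ) (fun j => ξ (Sum.inr j, p.2)) (y' p.2)) p.1

theorem contract_eq_extend (i : Fin k ⊕ Fin k) (z : Conf n k) :
    contract i z = extend z (part z i) (part z i) := rfl

@[simp] theorem part_apply (ξ : Conf n k) (i) (a) : part ξ i a = ξ (i, a) := rfl

@[simp] theorem extend_inl_castSucc (ξ : Conf n k) (y y' : Pt n) (j : Fin k) (a : Fin n) :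
    extend ξ y y' (Sum.inl j.castSucc, a) = ξ (Sum.inl j, a) := by simp [extend]

@[simp] theorem extend_inr_castSucc (ξ : Conf n k) (y y' : Pt n) (j : Fin k) (a : Fin n) :
    extend ξ y y' (Sum.inr j.castSucc, a) = ξ (Sum.inr j, a) := by simp [extend]

@[simp] theorem extend_inl_last (ξ : Conf n k) (y y' : Pt n) (a : Fin n) :
    extend ξ y y' (Sum.inl (Fin.last k), a) = y a := by simp [extend]

@[simp] theorem extend_inr_last (ξ : Conf n k) (y y' : Pt n) (a : Fin n) :
    extend ξ y y' (Sum.inr (Fin.last k), a) = y' a := by simp [extend]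

theorem conf_ext {ξ ζ : Conf n (k + 1)}
    (h1 : ∀ j : Fin k, ∀ a, ξ (Sum.inl j.castSucc, a) = ζ (Sum.inl j.castSucc, a))
    (h2 : ∀ j : Fin k, ∀ a, ξ (Sum.inr j.castSucc, a) = ζ (Sum.inr j.castSucc, a))
    (h3 : ∀ a, ξ (Sum.inl (Fin.last k), a) = ζ (Sum.inl (Fin.last k), a))
    (h4 : ∀ a, ξ (Sum.inr (Fin.last k), a) = ζ (Sum.inr (Fin.last k), a)) : ξ = ζ := by
  ext ⟨i, a⟩
  rcases i with j | j
  · exact j.lastCases (h3 a) fun j => h1 j a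
  · exact j.lastCases (h4 a) fun j => h2 j a

theorem inner_conf (ξ ζ : Conf n k) :
    inner ℝ ξ ζ = ∑ i, inner ℝ (part ξ i) (part ζ i) := by
  simp only [PiLp.inner_apply, Fintype.sum_prod_type, part_apply]

theorem inner_extend (ξ ζ : Conf n k) (y y' w w' : Pt n) :
    inner ℝ (extend ξ y y') (extend ζ w w') = inner ℝ ξ ζ + (inner ℝ y w + inner ℝ y' w') := by
  simp only [PiLp.inner_apply, Fintype.sum_prod_type, Fintype.sum_sum_type, Fin.sum_univ_castSucc,
    extend_inl_castSucc, extend_inr_castSucc, extend_inl_last, extend_inr_last]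
  ring

theorem inner_single (z : Conf n k) (i : Fin k ⊕ Fin k) (y : Pt n) :
    inner ℝ z (single i y) = inner ℝ (part z i) y := by
  rw [inner_conf, Finset.sum_eq_single i]
  · congr 1
    ext a
    simp [single]
  · intro j _ hj
    have : part (single i y) j = 0 := by
      ext a
      simp [single, hj]
    rw [this, inner_zero_right]
  · simp

/-- `extend` as a linear isometry equivalence. -/
def extendₗᵢ (n k : ℕ) :
    WithLp 2 (Conf n k × WithLp 2 (Pt n × Pt n)) ≃ₗᵢ[ℝ] Conf n (k + 1) :=
  LinearIsometry.toLinearIsometryEquiv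
    (LinearMap.isometryOfInner
      { toFun := fun p => extend p.fst p.snd.fst p.snd.snd
        map_add' := fun p q => by apply conf_ext <;> simp
        map_smul' := fun c p => by apply conf_ext <;> simp }
      fun p q => by
        simp only [LinearMap.coe_mk, AddHom.coe_mk, inner_extend, WithLp.prod_inner_apply]
        rfl)
    -- An isometry between spaces of equal finite dimension is onto.
    (by
      have h1 : Module.finrank ℝ (WithLp 2 (Conf n k × WithLp 2 (Pt n × Pt n))) =
          Module.finrank ℝ (Conf n k × (Pt n × Pt n)) :=
        ((WithLp.linearEquiv 2 ℝ _).trans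
          ((LinearEquiv.refl ℝ _).prodCongr (WithLp.linearEquiv 2 ℝ _))).finrank_eq
      rw [h1]
      simp only [Module.finrank_prod, finrank_euclideanSpace, Fintype.card_prod, Fintype.card_sum,
        Fintype.card_fin]
      ring)

theorem measurePreserving_extend :
    MeasurePreserving fun p : Conf n k × (Pt n × Pt n) => extend p.1 p.2.1 p.2.2 := by
  have h1 := (MeasurePreserving.id (volume : Measure (Conf n k))).prod
    (WithLp.volume_preserving_toLp (U := Pt n) (V := Pt n))
  have h2 := WithLp.volume_preserving_toLp (U := Conf n k) (V := WithLp 2 (Pt n × Pt n))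
  exact ((extendₗᵢ n k).measurePreserving.comp h2).comp h1

/-- The change of variables `(ξ, η, η') ↦ (ξ_1, …, ξ_i - η - η', …, η, η')`, dual to `contract`. -/
def spread (i : Fin k ⊕ Fin k) (p : Conf n k × (Pt n × Pt n)) : Conf n (k + 1) :=
  extend (p.1 - single i (p.2.1 + p.2.2)) p.2.1 p.2.2

theorem continuous_single (i : Fin k ⊕ Fin k) : Continuous (single i : Pt n → Conf n k) := by
  refine (PiLp.continuous_toLp 2 _).comp (continuous_pi fun p => ?_)
  by_cases h : p.1 = i
  · simp only [h, if_true]; fun_prop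
  · simp only [h, if_false]; fun_prop

/-- For fixed (η, η') the map translates ξ; this shear is followed by the volume-preserving
`extend`. -/
theorem measurePreserving_spread (i : Fin k ⊕ Fin k) :
    MeasurePreserving (spread i : Conf n k × (Pt n × Pt n) → Conf n (k + 1)) := by
  have hs : Measurable fun u : Pt n × Pt n => (single i (u.1 + u.2) : Conf n k) :=
    (continuous_single i).measurable.comp (measurable_fst.add measurable_snd)
  have h1 : MeasurePreserving
      (fun q : (Pt n × Pt n) × Conf n k => (q.1, q.2 - single i (q.1.1 + q.1.2)))
      (volume.prod volume) (volume.prod volume) :=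
    (MeasurePreserving.id (volume : Measure (Pt n × Pt n))).skew_product
      (g := fun u ξ => ξ - single i (u.1 + u.2))
      (measurable_snd.sub (hs.comp measurable_fst))
      (Filter.Eventually.of_forall fun u => (measurePreserving_sub_right volume _).map_eq)
  exact measurePreserving_extend.comp
    ((Measure.measurePreserving_swap.comp h1).comp Measure.measurePreserving_swap)

/-- The subtraction of η + η' in slot `i` cancels the phases of the two contracted particles, both
of which sit at the `i`-th position. -/
theorem inner_contract_spread (i : Fin k ⊕ Fin k) (z : Conf n k)
    (p : Conf n k × (Pt n × Pt n)) :
    inner ℝ (spread i p) (contract i z) = inner ℝ p.1 z := by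
  rw [contract_eq_extend, spread, inner_extend, inner_sub_left, real_inner_comm _ (single _ _),
    inner_single, inner_add_right, real_inner_comm _ p.2.1, real_inner_comm _ p.2.2]
  ring

end Geometry

/-! ### Sobolev weights and the Schur integral -/

section Weights

variable {n k : ℕ} {α : ℝ}

/-- The symbol of `1 - Δ` on the one-particle space. -/
def bracket (y : Pt n) : ℝ := 1 + (2 * Real.pi) ^ 2 * ‖y‖ ^ 2

theorem bracket_pos (y : Pt n) : 0 < bracket y := by unfold bracket; positivity

theorem continuous_bracket : Continuous (bracket : Pt n → ℝ) := by unfold bracket; fun_prop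

theorem one_add_lapSymbol (ξ : Conf n k) (i : Fin k ⊕ Fin k) :
    1 + lapSymbol ξ i = bracket (part ξ i) := by
  simp [lapSymbol, bracket, EuclideanSpace.norm_sq_eq]

theorem sobolevSymbol_eq (ξ : Conf n k) :
    sobolevSymbol α ξ = ∏ i, bracket (part ξ i) ^ (α / 2) := by
  simp only [sobolevSymbol, one_add_lapSymbol]

theorem one_le_sobolevSymbol (hα : 0 ≤ α) (ξ : Conf n k) : 1 ≤ sobolevSymbol α ξ :=
  Finset.one_le_prod fun i _ =>
    Real.one_le_rpow (by linarith [lapSymbol_nonneg ξ i]) (by positivity)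

theorem sobolevSymbol_extend (ξ : Conf n k) (y y' : Pt n) :
    sobolevSymbol α (extend ξ y y') =
      sobolevSymbol α ξ * (bracket y ^ (α / 2) * bracket y' ^ (α / 2)) := by
  have h1 : ∀ j : Fin k, part (extend ξ y y') (Sum.inl j.castSucc) = part ξ (Sum.inl j) :=
    fun j => by ext a; simp
  have h2 : ∀ j : Fin k, part (extend ξ y y') (Sum.inr j.castSucc) = part ξ (Sum.inr j) :=
    fun j => by ext a; simp
  have h3 : part (extend ξ y y') (Sum.inl (Fin.last k)) = y := by ext a; simp
  have h4 : part (extend ξ y y') (Sum.inr (Fin.last k)) = y' := by ext a; simp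
  simp only [sobolevSymbol_eq, Fintype.prod_sum_type, Fin.prod_univ_castSucc, h1, h2, h3, h4]
  ring

/-- Only the `i`-th factor of the product changes; the identity is cross-multiplied to avoid
division. -/
theorem sobolevSymbol_sub_single (ξ : Conf n k) (i : Fin k ⊕ Fin k) (y : Pt n) :
    sobolevSymbol α (ξ - single i y) * bracket (part ξ i) ^ (α / 2) =
      sobolevSymbol α ξ * bracket (part ξ i - y) ^ (α / 2) := by
  rw [sobolevSymbol_eq, sobolevSymbol_eq, ← Finset.mul_prod_erase _ _ (Finset.mem_univ i),
    ← Finset.mul_prod_erase Finset.univ (fun j => bracket (part ξ j) ^ (α / 2)) (Finset.mem_univ i)]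
  have h1 : part (ξ - single i y) i = part ξ i - y := by ext a; simp [single]
  have h2 : ∀ j ∈ Finset.univ.erase i, bracket (part (ξ - single i y) j) ^ (α / 2)
      = bracket (part ξ j) ^ (α / 2) := by
    intro j hj
    congr 2
    ext a
    simp [single, Finset.ne_of_mem_erase hj]
  rw [h1, Finset.prod_congr rfl h2]
  ring

/-- The one-particle weight `(1 + 4π²|y|²)^{-α}`. -/
def decay (α : ℝ) (y : Pt n) : ℝ≥0∞ := ENNReal.ofReal (bracket y ^ (-α))

theorem continuous_decay (α : ℝ) : Continuous (decay α : Pt n → ℝ≥0∞) :=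
  ENNReal.continuous_ofReal.comp (continuous_bracket.rpow_const fun y => Or.inl (bracket_pos y).ne')

/-- `∫ (1 + 4π²|y|²)^{-α} dy`. -/
def decayIntegral (n : ℕ) (α : ℝ) : ℝ≥0∞ := ∫⁻ y : Pt n, decay α y

theorem decayIntegral_lt_top (hα : (n : ℝ) / 2 < α) : decayIntegral n α < ∞ := by
  have hα0 : 0 ≤ α := le_trans (by positivity) hα.le
  have h1 : Integrable fun y : Pt n => (1 + ‖y‖ ^ 2) ^ (-(2 * α) / 2) :=
    integrable_rpow_neg_one_add_norm_sq (by rw [finrank_euclideanSpace, Fintype.card_fin]; linarith)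
  refine lt_of_le_of_lt (lintegral_mono fun y => ENNReal.ofReal_le_ofReal ?_) h1.lintegral_lt_top
  rw [show -(2 * α) / 2 = -α by ring]
  refine Real.rpow_le_rpow_of_nonpos (by positivity) ?_ (by linarith)
  unfold bracket
  have : (1 : ℝ) ≤ (2 * Real.pi) ^ 2 := by nlinarith [Real.pi_gt_three]
  gcongr
  exact le_mul_of_one_le_left (by positivity) this

theorem lintegral_decay_mul_decay :
    ∫⁻ p : Pt n × Pt n, decay α p.1 * decay α p.2 = decayIntegral n α ^ 2 := by
  have hm := (continuous_decay (n := n) α).measurable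
  rw [Measure.volume_eq_prod, lintegral_prod_mul hm.aemeasurable hm.aemeasurable, sq]
  rfl

/-- The weight factorises over particles, so each induction step multiplies the integral by
`decayIntegral n α ^ 2`; for `k = 0` the space is a point. -/
theorem lintegral_inv_sobolevSymbol_sq_lt_top (hα : (n : ℝ) / 2 < α) (k : ℕ) :
    ∫⁻ ξ : Conf n k, ENNReal.ofReal ((sobolevSymbol α ξ ^ 2)⁻¹) < ∞ := by
  induction k with
  | zero =>
    have h1 : ∀ ξ : Conf n 0, ENNReal.ofReal ((sobolevSymbol α ξ ^ 2)⁻¹) = 1 := fun ξ => by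
      simp [sobolevSymbol]
    simp_rw [h1, lintegral_one]
    have : (univ : Set (Conf n 0)) = {0} := eq_singleton_iff_unique_mem.2
      ⟨mem_univ _, fun x _ => Subsingleton.elim _ _⟩
    rw [this]
    exact isCompact_singleton.measure_lt_top
  | succ k ih =>
    have hm : ∀ k, Measurable fun ξ : Conf n k => ENNReal.ofReal ((sobolevSymbol α ξ ^ 2)⁻¹) :=
      fun k => (ENNReal.continuous_ofReal.comp (((continuous_sobolevSymbol α).pow 2).inv₀
        fun ξ => pow_ne_zero 2 (sobolevSymbol_pos α ξ).ne')).measurable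
    have hd := (continuous_decay (n := n) α).measurable
    rw [← measurePreserving_extend.lintegral_comp (hm (k + 1))]
    have h1 : ∀ p : Conf n k × (Pt n × Pt n),
        ENNReal.ofReal ((sobolevSymbol α (extend p.1 p.2.1 p.2.2) ^ 2)⁻¹) =
          ENNReal.ofReal ((sobolevSymbol α p.1 ^ 2)⁻¹) * (decay α p.2.1 * decay α p.2.2) := by
      intro p
      have hb : ∀ y : Pt n, ((bracket y ^ (α / 2)) ^ 2)⁻¹ = bracket y ^ (-α) := fun y => by
        rw [← Real.rpow_natCast, ← Real.rpow_mul (bracket_pos y).le, Real.rpow_neg (bracket_pos y).le]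
        norm_num
      have hb0 : ∀ y : Pt n, 0 ≤ bracket y ^ (-α) := fun y => Real.rpow_nonneg (bracket_pos y).le _
      rw [sobolevSymbol_extend, mul_pow, mul_pow, mul_inv, mul_inv, hb, hb, decay, decay,
        ENNReal.ofReal_mul (by positivity), ENNReal.ofReal_mul (hb0 _)]
    simp_rw [h1]
    have hu : Measurable fun u : Pt n × Pt n => decay α u.1 * decay α u.2 :=
      (hd.comp measurable_fst).mul (hd.comp measurable_snd)
    rw [Measure.volume_eq_prod, lintegral_prod_mul (hm k).aemeasurable hu.aemeasurable,
      lintegral_decay_mul_decay]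
    exact ENNReal.mul_lt_top ih (ENNReal.pow_lt_top (decayIntegral_lt_top hα))

/-- The bracket of the sum is at most 3 times the sum of the three brackets, so some single bracket
is at least one ninth of it; this gives the 9. -/
theorem bracket_add_le (hα : 0 ≤ α) (a b c : Pt n) :
    bracket (a + b + c) ^ α ≤ 9 ^ α * (bracket a ^ α + bracket b ^ α + bracket c ^ α) := by
  have h1 : bracket (a + b + c) ≤ 3 * (bracket a + bracket b + bracket c) := by
    have h := norm_add₃_le (a := a) (b := b) (c := c)
    have h2 : ‖a + b + c‖ ^ 2 ≤ 3 * (‖a‖ ^ 2 + ‖b‖ ^ 2 + ‖c‖ ^ 2) := by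
      have := pow_le_pow_left₀ (norm_nonneg _) h 2
      nlinarith [sq_nonneg (‖a‖ - ‖b‖), sq_nonneg (‖a‖ - ‖c‖), sq_nonneg (‖b‖ - ‖c‖)]
    have := mul_le_mul_of_nonneg_left h2 (sq_nonneg (2 * Real.pi))
    unfold bracket
    linarith
  have h0 := bracket_pos a
  have h0' := bracket_pos b
  have h0'' := bracket_pos c
  have key : ∀ d : Pt n, bracket (a + b + c) ≤ 9 * bracket d →
      bracket (a + b + c) ^ α ≤ 9 ^ α * bracket d ^ α := fun d hd => by
    rw [← Real.mul_rpow (by norm_num) (bracket_pos d).le]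
    exact Real.rpow_le_rpow (bracket_pos _).le hd hα
  have p := Real.rpow_nonneg h0.le α
  have p' := Real.rpow_nonneg h0'.le α
  have p'' := Real.rpow_nonneg h0''.le α
  have q : (0 : ℝ) ≤ 9 ^ α := by positivity
  by_cases ha : bracket (a + b + c) ≤ 9 * bracket a
  · exact (key a ha).trans (mul_le_mul_of_nonneg_left (by linarith) q)
  by_cases hb : bracket (a + b + c) ≤ 9 * bracket b
  · exact (key b hb).trans (mul_le_mul_of_nonneg_left (by linarith) q)
  · exact (key c (by linarith)).trans (mul_le_mul_of_nonneg_left (by linarith) q)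

/-- The Schur constant of the contraction. -/
def schurConst (n : ℕ) (α : ℝ) : ℝ≥0∞ := ENNReal.ofReal (9 ^ α) * (3 * decayIntegral n α ^ 2)

theorem schurConst_lt_top (hα : (n : ℝ) / 2 < α) : schurConst n α < ∞ :=
  ENNReal.mul_lt_top ENNReal.ofReal_lt_top
    (ENNReal.mul_lt_top (by simp) (ENNReal.pow_lt_top (decayIntegral_lt_top hα)))

theorem sobolevSymbol_spread (i : Fin k ⊕ Fin k) (ξ : Conf n k) (u : Pt n × Pt n) :
    (sobolevSymbol α ξ / sobolevSymbol α (spread i (ξ, u))) ^ 2 =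
      bracket (part ξ i) ^ α * (bracket (part ξ i - (u.1 + u.2)) ^ (-α) *
        bracket u.1 ^ (-α) * bracket u.2 ^ (-α)) := by
  have hb : ∀ y : Pt n, bracket y ^ α = (bracket y ^ (α / 2)) ^ 2 := fun y => by
    rw [← Real.rpow_natCast, ← Real.rpow_mul (bracket_pos y).le]
    norm_num
  have hp : ∀ y : Pt n, 0 < bracket y ^ (α / 2) := fun y => Real.rpow_pos_of_pos (bracket_pos y) _
  have h := sobolevSymbol_sub_single (α := α) ξ i (u.1 + u.2)
  have e1 := hp (part ξ i)
  have e2 := hp (part ξ i - (u.1 + u.2))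
  have e3 := hp u.1
  have e4 := hp u.2
  have e5 := sobolevSymbol_pos α (ξ - single i (u.1 + u.2))
  have hd : sobolevSymbol α ξ / sobolevSymbol α (spread i (ξ, u)) = bracket (part ξ i) ^ (α / 2) /
      (bracket (part ξ i - (u.1 + u.2)) ^ (α / 2) * bracket u.1 ^ (α / 2) *
        bracket u.2 ^ (α / 2)) := by
    rw [spread, sobolevSymbol_extend]
    field_simp
    linear_combination -h
  rw [hd]
  simp only [Real.rpow_neg (bracket_pos _).le, hb]
  field_simp

/-- The frequency in slot `i` is the sum of the three frequencies x - u₁ - u₂, u₁, u₂. After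
`bracket_add_le`, each of the three terms cancels one decay factor and leaves a product of two, with
integral `decayIntegral n α ^ 2`. -/
theorem lintegral_schur_le (hα : 0 ≤ α) (i : Fin k ⊕ Fin k) (ξ : Conf n k) :
    ∫⁻ u : Pt n × Pt n,
      ENNReal.ofReal ((sobolevSymbol α ξ / sobolevSymbol α (spread i (ξ, u))) ^ 2) ≤
        schurConst n α := by
  have hd := (continuous_decay (n := n) α).measurable
  set x := part ξ i with hxd
  have hle : ∀ u : Pt n × Pt n,
      ENNReal.ofReal ((sobolevSymbol α ξ / sobolevSymbol α (spread i (ξ, u))) ^ 2) ≤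
        ENNReal.ofReal (9 ^ α) * (decay α u.1 * decay α u.2 +
          (decay α (x - (u.1 + u.2)) * decay α u.2 + decay α (x - (u.1 + u.2)) * decay α u.1)) := by
    intro u
    have hp : ∀ y : Pt n, 0 < bracket y ^ α := fun y => Real.rpow_pos_of_pos (bracket_pos y) _
    have hp' : ∀ y : Pt n, 0 ≤ bracket y ^ (-α) := fun y => Real.rpow_nonneg (bracket_pos y).le _
    simp only [decay]
    rw [← ENNReal.ofReal_mul (hp' _), ← ENNReal.ofReal_mul (hp' _), ← ENNReal.ofReal_mul (hp' _),
      ← ENNReal.ofReal_add (mul_nonneg (hp' _) (hp' _)) (mul_nonneg (hp' _) (hp' _)),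
      ← ENNReal.ofReal_add (mul_nonneg (hp' _) (hp' _))
        (add_nonneg (mul_nonneg (hp' _) (hp' _)) (mul_nonneg (hp' _) (hp' _))),
      ← ENNReal.ofReal_mul (by positivity), sobolevSymbol_spread, ← hxd]
    refine ENNReal.ofReal_le_ofReal ?_
    have h := bracket_add_le hα (x - (u.1 + u.2)) u.1 u.2
    rw [show x - (u.1 + u.2) + u.1 + u.2 = x by abel] at h
    have e2 := hp (x - (u.1 + u.2))
    have e3 := hp u.1
    have e4 := hp u.2
    refine (mul_le_mul_of_nonneg_right h (mul_nonneg (mul_nonneg (hp' _) (hp' _)) (hp' _))).trans_eq ?_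
    simp only [Real.rpow_neg (bracket_pos _).le]
    field_simp
    ring
  refine (lintegral_mono hle).trans ?_
  have hx : Measurable fun u : Pt n × Pt n => decay α (x - (u.1 + u.2)) :=
    hd.comp (measurable_const.sub (measurable_fst.add measurable_snd))
  have h1 : Measurable fun u : Pt n × Pt n => decay α u.1 := hd.comp measurable_fst
  have h2 : Measurable fun u : Pt n × Pt n => decay α u.2 := hd.comp measurable_snd
  rw [lintegral_const_mul _ (by fun_prop), lintegral_add_left (by exact h1.mul h2),
    lintegral_add_left (by exact hx.mul h2), schurConst]
  -- The variable occurring in only one factor is integrated first, by invariance under translation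
  -- and reflection.
  have i1 : ∫⁻ u : Pt n × Pt n, decay α (x - (u.1 + u.2)) * decay α u.2 = decayIntegral n α ^ 2 := by
    rw [Measure.volume_eq_prod, lintegral_prod_symm' _ (by exact hx.mul h2)]
    have : ∀ y : Pt n, ∫⁻ z : Pt n, decay α (x - (z + y)) * decay α y =
        decayIntegral n α * decay α y := fun y => by
      rw [lintegral_mul_const _ (by fun_prop)]
      simp_rw [show ∀ z, x - (z + y) = (x - y) - z from fun z => by abel]
      rw [lintegral_sub_left_eq_self (fun z => decay α z) (x - y)]
      rfl
    simp_rw [this]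
    rw [lintegral_const_mul _ hd, sq]
    rfl
  have i2 : ∫⁻ u : Pt n × Pt n, decay α (x - (u.1 + u.2)) * decay α u.1 = decayIntegral n α ^ 2 := by
    rw [Measure.volume_eq_prod, lintegral_prod _ (by exact (hx.mul h1).aemeasurable)]
    have : ∀ y : Pt n, ∫⁻ z : Pt n, decay α (x - (y + z)) * decay α y =
        decayIntegral n α * decay α y := fun y => by
      rw [lintegral_mul_const _ (by fun_prop)]
      simp_rw [show ∀ z, x - (y + z) = (x - y) - z from fun z => by abel]
      rw [lintegral_sub_left_eq_self (fun z => decay α z) (x - y)]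
      rfl
    simp_rw [this]
    rw [lintegral_const_mul _ hd, sq]
    rfl
  rw [lintegral_decay_mul_decay, i1, i2]
  refine le_of_eq ?_
  ring

end Weights

/-! ### Continuous representatives and Fourier description of the Sobolev space -/

section SobolevSpace

variable {n k : ℕ} {α : ℝ}

theorem continuous_inv_sobolevSymbol :
    Continuous fun ξ : Conf n k => (((sobolevSymbol α ξ)⁻¹ : ℝ) : ℂ) :=
  Complex.continuous_ofReal.comp
    ((continuous_sobolevSymbol α).inv₀ fun ξ => (sobolevSymbol_pos α ξ).ne')

theorem memLp_inv_sobolevSymbol (hα : (n : ℝ) / 2 < α) (k : ℕ) :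
    MemLp (fun ξ : Conf n k => (((sobolevSymbol α ξ)⁻¹ : ℝ) : ℂ)) 2 volume := by
  refine (memLp_two_iff_integrable_sq_norm
    continuous_inv_sobolevSymbol.aestronglyMeasurable).2 ⟨?_, ?_⟩
  · exact (continuous_inv_sobolevSymbol.norm.pow 2).aestronglyMeasurable
  · rw [hasFiniteIntegral_iff_ofReal (Filter.Eventually.of_forall fun ξ => sq_nonneg _)]
    refine lt_of_eq_of_lt (lintegral_congr fun ξ => ?_) (lintegral_inv_sobolevSymbol_sq_lt_top hα k)
    rw [Complex.norm_real, Real.norm_of_nonneg (inv_nonneg.2 (sobolevSymbol_pos α ξ).le), inv_pow]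

/-- The transform is the product of two L² functions: the inverse weight, which is where α > n/2 is
used, and the weighted transform. -/
theorem Sob.integrable_fourier (hα : (n : ℝ) / 2 < α) (γ : Sob n k α) :
    Integrable (𝓕 γ.toL2 : L2 n k) := by
  refine ((memLp_inv_sobolevSymbol hα k).integrable_mul γ.memLp).congr
    (Filter.Eventually.of_forall fun ξ => ?_)
  have := (sobolevSymbol_pos α ξ).ne'
  simp only [Pi.mul_apply]
  rw [← mul_assoc, ← Complex.ofReal_mul, inv_mul_cancel₀ this, Complex.ofReal_one, one_mul]

/-- The continuous representative. -/
def Sob.rep (γ : Sob n k α) : Conf n k → ℂ := 𝓕⁻ ((𝓕 γ.toL2 : L2 n k) : Conf n k → ℂ)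

theorem Sob.continuous_rep (hα : (n : ℝ) / 2 < α) (γ : Sob n k α) : Continuous γ.rep :=
  continuous_fourierInv_of_integrable (γ.integrable_fourier hα)

theorem Sob.toL2_ae_eq_rep (hα : (n : ℝ) / 2 < α) (γ : Sob n k α) :
    γ.toL2 =ᵐ[volume] γ.rep := by
  have h := coeFn_fourierInv_ae_eq (𝓕 γ.toL2 : L2 n k) (γ.integrable_fourier hα)
  rwa [show (𝓕⁻ (𝓕 γ.toL2 : L2 n k) : L2 n k) = γ.toL2 from
    (Lp.fourierTransformₗᵢ (Conf n k) ℂ).symm_apply_apply _] at h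

theorem Sob.ext_toL2 {γ ρ : Sob n k α} (h : γ.toL2 = ρ.toL2) : γ = ρ := Subtype.ext h

theorem Sob.norm_eq (γ : Sob n k α) : ‖γ‖ = ‖Sob.weighted γ‖ := rfl

theorem Sob.coeFn_weighted (γ : Sob n k α) :
    Sob.weighted γ =ᵐ[volume] fun ξ => (sobolevSymbol α ξ : ℂ) * (𝓕 γ.toL2 : L2 n k) ξ :=
  γ.memLp.coeFn_toLp

theorem Sob.enorm_eq (γ : Sob n k α) :
    ‖γ‖ₑ = eLpNorm (fun ξ => (sobolevSymbol α ξ : ℂ) * (𝓕 γ.toL2 : L2 n k) ξ) 2 volume := by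
  rw [← eLpNorm_congr_ae γ.coeFn_weighted, ← Lp.enorm_def, ← ofReal_norm, ← ofReal_norm,
    Sob.norm_eq]

/-- The element of the Sobolev space with a given Fourier transform. -/
theorem Sob.exists_of_fourier (hα : 0 ≤ α) {G : Conf n k → ℂ} (hG : AEStronglyMeasurable G volume)
    (hWG : MemLp (fun ξ => (sobolevSymbol α ξ : ℂ) * G ξ) 2 volume) :
    ∃ g : Sob n k α, (𝓕 g.toL2 : L2 n k) =ᵐ[volume] G := by
  have hG2 : MemLp G 2 volume := hWG.mono hG (Filter.Eventually.of_forall fun ξ => by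
    rw [norm_mul, Complex.norm_real, Real.norm_of_nonneg (sobolevSymbol_pos α ξ).le]
    exact le_mul_of_one_le_left (norm_nonneg _) (one_le_sobolevSymbol hα ξ))
  have hF : (𝓕 (𝓕⁻ (hG2.toLp) : L2 n k) : L2 n k) = hG2.toLp :=
    (Lp.fourierTransformₗᵢ (Conf n k) ℂ).apply_symm_apply _
  have hae : (𝓕 (𝓕⁻ (hG2.toLp) : L2 n k) : L2 n k) =ᵐ[volume] G := by
    rw [hF]
    exact hG2.coeFn_toLp
  refine ⟨⟨𝓕⁻ (hG2.toLp), (memLp_congr_ae ?_).2 hWG⟩, hae⟩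
  filter_upwards [hae] with ξ hξ
  rw [hξ]

/-- The underlying element of `L²`, as a continuous linear map. -/
def Sob.toL2L (hα : 0 ≤ α) : Sob n k α →L[ℂ] L2 n k :=
  LinearMap.mkContinuous
    { toFun := Sob.toL2
      map_add' := fun _ _ => rfl
      map_smul' := fun _ _ => rfl } 1 fun γ => by
    have h1 : ‖γ.toL2‖ = ‖(𝓕 γ.toL2 : L2 n k)‖ := (Lp.norm_fourier_eq γ.toL2).symm
    change ‖γ.toL2‖ ≤ 1 * ‖γ‖
    rw [one_mul, h1, Sob.norm_eq]
    refine Lp.norm_le_norm_of_ae_le ?_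
    filter_upwards [γ.coeFn_weighted] with ξ hξ
    rw [hξ, norm_mul, Complex.norm_real, Real.norm_of_nonneg (sobolevSymbol_pos α ξ).le]
    exact le_mul_of_one_le_left (norm_nonneg _) (one_le_sobolevSymbol hα ξ)

end SobolevSpace

/-! ### Boundedness of a single contraction -/

section Contraction

variable {n k : ℕ} {α : ℝ}

/-- The Fourier transform of the contraction of a function with Fourier transform `F`. -/
def contractFourier (i : Fin k ⊕ Fin k) (F : Conf n (k + 1) → ℂ) (ξ : Conf n k) : ℂ :=
  ∫ u, F (spread i (ξ, u))

theorem integrable_comp_spread (i : Fin k ⊕ Fin k) {F : Conf n (k + 1) → ℂ} (hF : Integrable F) :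
    Integrable (fun p => F (spread i p)) (volume.prod volume) :=
  (measurePreserving_spread i).integrable_comp_of_integrable hF

theorem integrable_contractFourier (i : Fin k ⊕ Fin k) {F : Conf n (k + 1) → ℂ}
    (hF : Integrable F) : Integrable (contractFourier i F) :=
  (integrable_comp_spread i hF).integral_prod_left

/-- Change variables by the measure-preserving `spread` and apply Fubini; by `inner_contract_spread`
the phase depends on ξ alone and leaves the inner integral. -/
theorem fourierInv_contractFourier (i : Fin k ⊕ Fin k) {F : Conf n (k + 1) → ℂ}
    (hF : Integrable F) (z : Conf n k) :
    𝓕⁻ (contractFourier i F) z = 𝓕⁻ F (contract i z) := by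
  rw [Real.fourierInv_eq, Real.fourierInv_eq]
  set f : Conf n (k + 1) → ℂ := fun ζ => Real.fourierChar (inner ℝ ζ (contract i z)) • F ζ with hf
  have hfi : Integrable f := by
    have := (Real.fourierIntegral_convergent_iff (μ := volume) (f := F) (-(contract i z))).2 hF
    simpa [hf] using this
  have h1 : ∫ ζ, f ζ = ∫ p : Conf n k × (Pt n × Pt n), f (spread i p) := by
    rw [← (measurePreserving_spread i).map_eq, integral_map
      (measurePreserving_spread i).measurable.aemeasurable]
    rw [(measurePreserving_spread i).map_eq]
    exact hfi.aestronglyMeasurable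
  rw [h1, Measure.volume_eq_prod, integral_prod (fun p => f (spread i p))
    ((measurePreserving_spread i).integrable_comp_of_integrable hfi)]
  refine integral_congr_ae (Filter.Eventually.of_forall fun ξ => ?_)
  simp only [hf, inner_contract_spread, contractFourier, Circle.smul_def]
  rw [integral_smul]

/-- Cauchy-Schwarz, after splitting the integrand into the quotient of weights `r` and the weighted
function `q`; the square integral of `r` is the Schur integral. -/
theorem enorm_contractFourier_sq_le (hα : 0 ≤ α) (i : Fin k ⊕ Fin k) {F : Conf n (k + 1) → ℂ}
    (hF : StronglyMeasurable F) (ξ : Conf n k) :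
    ‖(sobolevSymbol α ξ : ℂ) * contractFourier i F ξ‖ₑ ^ 2 ≤
      schurConst n α * ∫⁻ u, ‖(sobolevSymbol α (spread i (ξ, u)) : ℂ) * F (spread i (ξ, u))‖ₑ ^ 2 := by
  have hsp : Measurable fun u => spread i (ξ, u) :=
    (measurePreserving_spread i).measurable.comp measurable_prodMk_left
  have hWm : Measurable fun u => sobolevSymbol α (spread i (ξ, u)) :=
    (continuous_sobolevSymbol α).measurable.comp hsp
  set r : Pt n × Pt n → ℝ≥0∞ := fun u =>
    ENNReal.ofReal (sobolevSymbol α ξ / sobolevSymbol α (spread i (ξ, u))) with hr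
  set q : Pt n × Pt n → ℝ≥0∞ := fun u =>
    ‖(sobolevSymbol α (spread i (ξ, u)) : ℂ) * F (spread i (ξ, u))‖ₑ with hq
  have hrm : Measurable r := (measurable_const.div hWm).ennreal_ofReal
  have hqm : Measurable q :=
    ((Complex.measurable_ofReal.comp hWm).mul (hF.measurable.comp hsp)).enorm
  have h1 : ‖(sobolevSymbol α ξ : ℂ) * contractFourier i F ξ‖ₑ ≤ ∫⁻ u, r u * q u := by
    rw [contractFourier, ← integral_const_mul]
    refine (enorm_integral_le_lintegral_enorm _).trans (lintegral_mono fun u => le_of_eq ?_)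
    have e1 := sobolevSymbol_pos α ξ
    have e2 := sobolevSymbol_pos α (spread i (ξ, u))
    simp only [hr, hq]
    rw [enorm_mul, enorm_mul, ← mul_assoc]
    congr 1
    rw [← ofReal_norm, ← ofReal_norm, Complex.norm_real, Complex.norm_real,
      Real.norm_of_nonneg e1.le, Real.norm_of_nonneg e2.le, ← ENNReal.ofReal_mul (by positivity)]
    congr 1
    field_simp
  have h2 := ENNReal.lintegral_mul_le_Lp_mul_Lq volume Real.HolderConjugate.two_two
    hrm.aemeasurable hqm.aemeasurable
  have h3 := pow_le_pow_left₀ zero_le (h1.trans h2) 2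
  refine h3.trans ?_
  rw [mul_pow, ← ENNReal.rpow_natCast, ← ENNReal.rpow_natCast, ← ENNReal.rpow_mul,
    ← ENNReal.rpow_mul]
  norm_num only [ENNReal.rpow_one]
  simp only [ENNReal.rpow_ofNat]
  refine mul_le_mul_left ?_ _
  refine le_trans (le_of_eq ?_) (lintegral_schur_le hα i ξ)
  refine lintegral_congr fun u => ?_
  simp only [hr]
  rw [ENNReal.ofReal_pow (div_nonneg (sobolevSymbol_pos α ξ).le (sobolevSymbol_pos α _).le)]

/-- Integrate the pointwise bound in ξ; Tonelli and measure preservation of `spread` restore the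
full norm of F. -/
theorem eLpNorm_contractFourier_le (hα : 0 ≤ α) (i : Fin k ⊕ Fin k) {F : Conf n (k + 1) → ℂ}
    (hF : StronglyMeasurable F) :
    eLpNorm (fun ξ => (sobolevSymbol α ξ : ℂ) * contractFourier i F ξ) 2 volume ≤
      schurConst n α ^ (1 / 2 : ℝ) *
        eLpNorm (fun ζ => (sobolevSymbol α ζ : ℂ) * F ζ) 2 volume := by
  have hWF : Measurable fun ζ : Conf n (k + 1) => ‖(sobolevSymbol α ζ : ℂ) * F ζ‖ₑ ^ 2 :=
    (((Complex.measurable_ofReal.comp (continuous_sobolevSymbol α).measurable).mul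
      hF.measurable).enorm).pow_const 2
  rw [eLpNorm_eq_lintegral_rpow_enorm_toReal two_ne_zero ENNReal.ofNat_ne_top,
    eLpNorm_eq_lintegral_rpow_enorm_toReal two_ne_zero ENNReal.ofNat_ne_top, ENNReal.toReal_ofNat,
    ← ENNReal.mul_rpow_of_nonneg _ _ (by norm_num : (0 : ℝ) ≤ 1 / 2)]
  refine ENNReal.rpow_le_rpow ?_ (by norm_num)
  simp_rw [ENNReal.rpow_ofNat]
  refine (lintegral_mono fun ξ => enorm_contractFourier_sq_le hα i hF ξ).trans ?_
  have hm : Measurable fun p : Conf n k × (Pt n × Pt n) =>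
      ‖(sobolevSymbol α (spread i p) : ℂ) * F (spread i p)‖ₑ ^ 2 :=
    hWF.comp (measurePreserving_spread i).measurable
  rw [lintegral_const_mul _ hm.lintegral_prod_right', ← lintegral_prod _ hm.aemeasurable,
    ← Measure.volume_eq_prod, (measurePreserving_spread i).lintegral_comp hWF]

theorem exists_contraction (hα : (n : ℝ) / 2 < α) (i : Fin k ⊕ Fin k) (γ : Sob n (k + 1) α) :
    ∃ g : Sob n k α, g.toL2 =ᵐ[volume] (fun z => γ.rep (contract i z)) ∧
      ‖g‖ ≤ (schurConst n α ^ (1 / 2 : ℝ)).toReal * ‖γ‖ := by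
  have hα0 : 0 ≤ α := le_trans (by positivity) hα.le
  have hFi := γ.integrable_fourier hα
  set F : Conf n (k + 1) → ℂ := ((𝓕 γ.toL2 : L2 n (k + 1)) : Conf n (k + 1) → ℂ) with hF
  have hFm : StronglyMeasurable F := Lp.stronglyMeasurable _
  have hle := eLpNorm_contractFourier_le hα0 i hFm
  rw [← Sob.enorm_eq] at hle
  have hK : schurConst n α ^ (1 / 2 : ℝ) < ∞ :=
    ENNReal.rpow_lt_top_of_nonneg (by norm_num) (schurConst_lt_top hα).ne
  have hGi := integrable_contractFourier i hFi
  have hWG : MemLp (fun ξ => (sobolevSymbol α ξ : ℂ) * contractFourier i F ξ) 2 volume :=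
    ⟨(Complex.continuous_ofReal.comp (continuous_sobolevSymbol α)).aestronglyMeasurable.mul
      hGi.aestronglyMeasurable, hle.trans_lt (ENNReal.mul_lt_top hK enorm_lt_top)⟩
  obtain ⟨g, hg⟩ := Sob.exists_of_fourier hα0 hGi.aestronglyMeasurable hWG
  refine ⟨g, ?_, ?_⟩
  · filter_upwards [g.toL2_ae_eq_rep hα] with z hz
    rw [hz, Sob.rep, Real.fourierInv_congr_ae hg, fourierInv_contractFourier i hFi]
    rfl
  · have h1 : ‖g‖ₑ ≤ schurConst n α ^ (1 / 2 : ℝ) * ‖γ‖ₑ := by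
      rw [Sob.enorm_eq]
      refine (eLpNorm_congr_ae ?_).trans_le hle
      filter_upwards [hg] with ξ hξ
      rw [hξ]
    have h2 := ENNReal.toReal_mono (ENNReal.mul_ne_top hK.ne enorm_ne_top) h1
    rwa [ENNReal.toReal_mul, toReal_enorm, toReal_enorm] at h2

end Contraction

/-! ### The collision operator -/

section Collision

variable {n k : ℕ} {α : ℝ}

/-- Lebesgue measure charges every nonempty open set, so continuous representatives are unique. This
also makes the operator chosen in `collision` linear. -/
theorem IsCollision.unique {γ : Sob n (k + 1) α} {g g' : Sob n k α} (h : IsCollision γ g)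
    (h' : IsCollision γ g') : g = g' := by
  obtain ⟨c, hc, hγ, hg⟩ := h
  obtain ⟨c', hc', hγ', hg'⟩ := h'
  have e : c = c' := (hc.ae_eq_iff_eq volume hc').1 (hγ.symm.trans hγ')
  subst e
  exact Sob.ext_toL2 (Lp.ext (hg.trans hg'.symm))

theorem Sob.toL2_add (γ ρ : Sob n k α) : (γ + ρ).toL2 =ᵐ[volume] fun z => γ.toL2 z + ρ.toL2 z :=
  Lp.coeFn_add γ.toL2 ρ.toL2

theorem Sob.toL2_smul (c : ℂ) (γ : Sob n k α) : (c • γ).toL2 =ᵐ[volume] fun z => c * γ.toL2 z :=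
  Lp.coeFn_smul c γ.toL2

theorem Sob.toL2_sub (γ ρ : Sob n k α) : (γ - ρ).toL2 =ᵐ[volume] fun z => γ.toL2 z - ρ.toL2 z :=
  Lp.coeFn_sub γ.toL2 ρ.toL2

theorem Sob.toL2_sum {ι : Type*} (s : Finset ι) (g : ι → Sob n k α) (f : ι → Conf n k → ℂ)
    (h : ∀ j, (g j).toL2 =ᵐ[volume] f j) :
    (∑ j ∈ s, g j).toL2 =ᵐ[volume] fun z => ∑ j ∈ s, f j z := by
  classical
  induction s using Finset.induction_on with
  | empty =>
    simp only [Finset.sum_empty]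
    exact Lp.coeFn_zero ℂ 2 volume
  | insert a s ha ih =>
    simp only [Finset.sum_insert ha]
    filter_upwards [Sob.toL2_add (g a) (∑ j ∈ s, g j), h a, ih] with z h1 h2 h3
    rw [h1, h2, h3]

theorem IsCollision.add {γ ρ : Sob n (k + 1) α} {g r : Sob n k α} (h : IsCollision γ g)
    (h' : IsCollision ρ r) : IsCollision (γ + ρ) (g + r) := by
  obtain ⟨c, hc, hγ, hg⟩ := h
  obtain ⟨d, hd, hρ, hr⟩ := h'
  refine ⟨fun z => c z + d z, hc.add hd, ?_, ?_⟩
  · filter_upwards [Sob.toL2_add γ ρ, hγ, hρ] with z h1 h2 h3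
    rw [h1, h2, h3]
  · filter_upwards [Sob.toL2_add g r, hg, hr] with z h1 h2 h3
    rw [h1, h2, h3, ← Finset.sum_add_distrib]
    exact Finset.sum_congr rfl fun j _ => by ring

theorem IsCollision.smul {γ : Sob n (k + 1) α} {g : Sob n k α} (a : ℂ) (h : IsCollision γ g) :
    IsCollision (a • γ) (a • g) := by
  obtain ⟨c, hc, hγ, hg⟩ := h
  refine ⟨fun z => a * c z, continuous_const.mul hc, ?_, ?_⟩
  · filter_upwards [Sob.toL2_smul a γ, hγ] with z h1 h2
    rw [h1, h2]
  · filter_upwards [Sob.toL2_smul a g, hg] with z h1 h2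
    rw [h1, h2, Finset.mul_sum]
    exact Finset.sum_congr rfl fun j _ => by ring

/-- The constant in the bound of the collision operator. -/
def collisionConst (n : ℕ) (α : ℝ) : ℝ := 2 * (schurConst n α ^ (1 / 2 : ℝ)).toReal + 1

theorem collisionConst_pos : 0 < collisionConst n α := by unfold collisionConst; positivity

theorem exists_collision (hα : (n : ℝ) / 2 < α) (γ : Sob n (k + 1) α) :
    ∃ g : Sob n k α, IsCollision γ g ∧ ‖g‖ ≤ collisionConst n α * k * ‖γ‖ := by
  choose g hg hgn using fun i : Fin k ⊕ Fin k => exists_contraction hα i γ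
  refine ⟨∑ j, (g (Sum.inl j) - g (Sum.inr j)), ⟨γ.rep, γ.continuous_rep hα,
    γ.toL2_ae_eq_rep hα, ?_⟩, ?_⟩
  · refine Sob.toL2_sum _ _
      (fun j z => γ.rep (contract (Sum.inl j) z) - γ.rep (contract (Sum.inr j) z)) fun j => ?_
    filter_upwards [Sob.toL2_sub (g (Sum.inl j)) (g (Sum.inr j)), hg (Sum.inl j), hg (Sum.inr j)]
      with z h1 h2 h3
    rw [h1, h2, h3]
  · refine (norm_sum_le _ _).trans ((Finset.sum_le_card_nsmul _ _
      (collisionConst n α * ‖γ‖) fun j _ => ?_).trans_eq ?_)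
    · refine (norm_sub_le _ _).trans ((add_le_add (hgn _) (hgn _)).trans ?_)
      -- The two contractions in each summand account for twice the Schur factor; the additional 1
      -- only keeps the constant strictly positive.
      unfold collisionConst
      nlinarith [norm_nonneg γ]
    · rw [Finset.card_univ, Fintype.card_fin, nsmul_eq_mul]
      ring

/-- The collision operator `B^{(k)}`. -/
def collision (hα : (n : ℝ) / 2 < α) (k : ℕ) : Sob n (k + 1) α →L[ℂ] Sob n k α :=
  LinearMap.mkContinuous
    { toFun := fun γ => (exists_collision hα γ).choose
      map_add' := fun γ ρ => (exists_collision hα (γ + ρ)).choose_spec.1.unique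
        ((exists_collision hα γ).choose_spec.1.add (exists_collision hα ρ).choose_spec.1)
      map_smul' := fun c γ => (exists_collision hα (c • γ)).choose_spec.1.unique
        ((exists_collision hα γ).choose_spec.1.smul c) }
    (collisionConst n α * k) fun γ => (exists_collision hα γ).choose_spec.2

theorem isCollision_collision (hα : (n : ℝ) / 2 < α) (γ : Sob n (k + 1) α) :
    IsCollision γ (collision hα k γ) := (exists_collision hα γ).choose_spec.1

theorem norm_collision_le (hα : (n : ℝ) / 2 < α) (γ : Sob n (k + 1) α) :
    ‖collision hα k γ‖ ≤ collisionConst n α * k * ‖γ‖ := (exists_collision hα γ).choose_spec.2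

end Collision

/-! ### The free propagator as a strongly continuous isometric group -/

section Propagator

variable {n k : ℕ} {α : ℝ}

theorem Sob.ext_fourier {γ ρ : Sob n k α}
    (h : (𝓕 γ.toL2 : L2 n k) =ᵐ[volume] (𝓕 ρ.toL2 : L2 n k)) : γ = ρ :=
  Sob.ext_toL2 ((Lp.fourierTransformₗᵢ (Conf n k) ℂ).injective (Lp.ext h))

theorem Sob.fourier_add (γ ρ : Sob n k α) : (𝓕 (γ + ρ).toL2 : L2 n k) =ᵐ[volume]
    fun ξ => (𝓕 γ.toL2 : L2 n k) ξ + (𝓕 ρ.toL2 : L2 n k) ξ := by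
  rw [show (𝓕 (γ + ρ).toL2 : L2 n k) = 𝓕 γ.toL2 + 𝓕 ρ.toL2 from
    (Lp.fourierTransformₗᵢ (Conf n k) ℂ).map_add γ.toL2 ρ.toL2]
  exact Lp.coeFn_add _ _

theorem Sob.fourier_smul (c : ℂ) (γ : Sob n k α) : (𝓕 (c • γ).toL2 : L2 n k) =ᵐ[volume]
    fun ξ => c * (𝓕 γ.toL2 : L2 n k) ξ := by
  rw [show (𝓕 (c • γ).toL2 : L2 n k) = c • 𝓕 γ.toL2 from
    (Lp.fourierTransformₗᵢ (Conf n k) ℂ).map_smul c γ.toL2]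
  exact Lp.coeFn_smul _ _

theorem fourier_prop (t : ℝ) (γ : Sob n k α) : (𝓕 (prop t γ).toL2 : L2 n k) =ᵐ[volume]
    fun ξ => propSymbol t ξ * (𝓕 γ.toL2 : L2 n k) ξ := fourier_propL2 t γ.toL2

theorem propSymbol_add (s t : ℝ) (ξ : Conf n k) :
    propSymbol (s + t) ξ = propSymbol s ξ * propSymbol t ξ := by
  simp only [propSymbol, ← Complex.exp_add]
  congr 1
  push_cast
  ring

theorem propSymbol_zero (ξ : Conf n k) : propSymbol 0 ξ = 1 := by simp [propSymbol]

theorem prop_zero (γ : Sob n k α) : prop 0 γ = γ :=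
  Sob.ext_fourier <| (fourier_prop 0 γ).trans <| Filter.Eventually.of_forall fun ξ => by
    simp [propSymbol_zero]

theorem prop_add_time (s t : ℝ) (γ : Sob n k α) : prop (s + t) γ = prop s (prop t γ) := by
  refine Sob.ext_fourier ?_
  filter_upwards [fourier_prop (s + t) γ, fourier_prop s (prop t γ), fourier_prop t γ]
    with ξ h1 h2 h3
  rw [h1, h2, h3, propSymbol_add, mul_assoc]

theorem prop_add (t : ℝ) (γ ρ : Sob n k α) : prop t (γ + ρ) = prop t γ + prop t ρ := by
  refine Sob.ext_fourier ?_
  filter_upwards [fourier_prop t (γ + ρ), Sob.fourier_add (prop t γ) (prop t ρ),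
    fourier_prop t γ, fourier_prop t ρ, Sob.fourier_add γ ρ] with ξ h1 h2 h3 h4 h5
  rw [h1, h2, h3, h4, h5, mul_add]

theorem prop_smul (t : ℝ) (c : ℂ) (γ : Sob n k α) : prop t (c • γ) = c • prop t γ := by
  refine Sob.ext_fourier ?_
  filter_upwards [fourier_prop t (c • γ), Sob.fourier_smul c (prop t γ),
    fourier_prop t γ, Sob.fourier_smul c γ] with ξ h1 h2 h3 h4
  rw [h1, h2, h3, h4, mul_left_comm]

theorem norm_prop (t : ℝ) (γ : Sob n k α) : ‖prop t γ‖ = ‖γ‖ := by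
  rw [← toReal_enorm, ← toReal_enorm, Sob.enorm_eq, Sob.enorm_eq]
  congr 1
  refine eLpNorm_congr_norm_ae ?_
  filter_upwards [fourier_prop t γ] with ξ h
  rw [h, norm_mul, norm_mul, norm_mul, norm_propSymbol, one_mul]

/-- The propagator as a continuous linear map. -/
def propL (n k : ℕ) (α : ℝ) (t : ℝ) : Sob n k α →L[ℂ] Sob n k α :=
  LinearMap.mkContinuous
    { toFun := prop t
      map_add' := prop_add t
      map_smul' := prop_smul t } 1 fun γ => by
    rw [one_mul]
    exact (norm_prop t γ).le

theorem propL_apply (t : ℝ) (γ : Sob n k α) : propL n k α t γ = prop t γ := rfl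

theorem enorm_prop_sub_sq (t : ℝ) (γ : Sob n k α) :
    ‖prop t γ - γ‖ₑ ^ 2 = ∫⁻ ξ, ‖(propSymbol t ξ - 1) *
      ((sobolevSymbol α ξ : ℂ) * (𝓕 γ.toL2 : L2 n k) ξ)‖ₑ ^ 2 := by
  have h : (fun ξ => (sobolevSymbol α ξ : ℂ) * (𝓕 (prop t γ - γ).toL2 : L2 n k) ξ) =ᵐ[volume]
      fun ξ => (propSymbol t ξ - 1) * ((sobolevSymbol α ξ : ℂ) * (𝓕 γ.toL2 : L2 n k) ξ) := by
    rw [sub_eq_add_neg, ← neg_one_smul ℂ γ]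
    filter_upwards [Sob.fourier_add (prop t γ) ((-1 : ℂ) • γ), fourier_prop t γ,
      Sob.fourier_smul (-1) γ] with ξ h1 h2 h3
    rw [h1, h2, h3]
    ring
  rw [Sob.enorm_eq, eLpNorm_congr_ae h,
    eLpNorm_eq_lintegral_rpow_enorm_toReal two_ne_zero ENNReal.ofNat_ne_top, ENNReal.toReal_ofNat,
    ← ENNReal.rpow_natCast, ← ENNReal.rpow_mul]
  simp

/-- At time 0 this is dominated convergence on the Fourier side, with the square of the factor
`propSymbol t ξ - 1` bounded by 4. The group law and isometry carry it to every other time. -/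
theorem continuous_prop (γ : Sob n k α) : Continuous fun t => prop t γ := by
  have h0 : Filter.Tendsto (fun t : ℝ => ‖prop t γ - γ‖ₑ ^ 2) (nhds 0) (nhds 0) := by
    simp_rw [enorm_prop_sub_sq]
    set f : Conf n k → ℂ := fun ξ => (sobolevSymbol α ξ : ℂ) * (𝓕 γ.toL2 : L2 n k) ξ with hf
    have hfm : MemLp f 2 volume := γ.memLp
    have hz : ∫⁻ _ : Conf n k, (0 : ℝ≥0∞) = 0 := lintegral_zero
    rw [← hz]
    refine tendsto_lintegral_filter_of_dominated_convergence' (fun ξ => 4 * ‖f ξ‖ₑ ^ 2) ?_ ?_ ?_ ?_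
    · exact Filter.Eventually.of_forall fun t =>
        ((((continuous_propSymbol t).sub continuous_const).aestronglyMeasurable.mul
          hfm.1).enorm).pow_const 2
    · refine Filter.Eventually.of_forall fun t => Filter.Eventually.of_forall fun ξ => ?_
      have h1 : ‖propSymbol t ξ - 1‖ₑ ≤ 2 := by
        refine (enorm_sub_le).trans ?_
        rw [← ofReal_norm, norm_propSymbol, ← ofReal_norm, norm_one, ENNReal.ofReal_one]
        norm_num
      rw [enorm_mul, mul_pow]
      refine mul_le_mul_left ((pow_le_pow_left₀ zero_le h1 2).trans_eq ?_) _
      norm_num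
    · have h2 := hfm.2
      rw [eLpNorm_lt_top_iff_lintegral_rpow_enorm_lt_top two_ne_zero ENNReal.ofNat_ne_top] at h2
      rw [lintegral_const_mul'' _ (hfm.1.enorm.pow_const 2)]
      refine (ENNReal.mul_lt_top (by simp) ?_).ne
      simpa using h2
    · refine Filter.Eventually.of_forall fun ξ => ?_
      have hc : Continuous fun t : ℝ => ‖(propSymbol t ξ - 1) * f ξ‖ₑ ^ 2 := by
        refine (ENNReal.continuous_pow 2).comp (Continuous.enorm ?_)
        unfold propSymbol
        fun_prop
      have := hc.tendsto 0
      simp only [propSymbol_zero, sub_self, zero_mul, enorm_zero, ne_eq, OfNat.ofNat_ne_zero,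
        not_false_eq_true, zero_pow] at this
      exact this
  have h1 : Filter.Tendsto (fun t : ℝ => ‖prop t γ - γ‖) (nhds 0) (nhds 0) := by
    have h2 := ((ENNReal.tendsto_toReal (ENNReal.zero_ne_top)).comp h0).sqrt
    refine (h2.congr fun t => ?_).trans_eq (by simp)
    simp [Function.comp, ENNReal.toReal_pow, toReal_enorm, Real.sqrt_sq]
  refine continuous_iff_continuousAt.2 fun t₀ => ?_
  refine tendsto_iff_norm_sub_tendsto_zero.2 ?_
  have h3 : Filter.Tendsto (fun t : ℝ => t - t₀) (nhds t₀) (nhds 0) :=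
    tendsto_sub_nhds_zero_iff.2 Filter.tendsto_id
  refine (h1.comp h3).congr fun t => ?_
  have e : prop t γ - prop t₀ γ = propL n k α t₀ (prop (t - t₀) γ - γ) := by
    rw [map_sub, propL_apply, propL_apply, ← prop_add_time]
    congr 2
    ring
  rw [e, propL_apply, norm_prop]
  rfl

end Propagator

/-! ### Symmetry of density matrices -/

section Symmetry

variable {n k : ℕ} {α : ℝ}

/-- Relabelling of the particles. -/
def relabel (n : ℕ) {k : ℕ} (τ : Equiv.Perm (Fin k ⊕ Fin k)) : Conf n k ≃ₗᵢ[ℝ] Conf n k :=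
  LinearIsometryEquiv.piLpCongrLeft 2 ℝ ℝ (τ.symm.prodCongr (Equiv.refl (Fin n)))

theorem relabel_apply (τ : Equiv.Perm (Fin k ⊕ Fin k)) (z : Conf n k) (p) :
    relabel n τ z p = z (τ p.1, p.2) := rfl

theorem lapSymbol_relabel (τ : Equiv.Perm (Fin k ⊕ Fin k)) (ξ : Conf n k) (i) :
    lapSymbol (relabel n τ ξ) i = lapSymbol ξ (τ i) := rfl

theorem sobolevSymbol_relabel (τ : Equiv.Perm (Fin k ⊕ Fin k)) (ξ : Conf n k) :
    sobolevSymbol α (relabel n τ ξ) = sobolevSymbol α ξ :=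
  Equiv.prod_comp τ fun i => (1 + lapSymbol ξ i) ^ (α / 2)

theorem lapSymbol_neg (ξ : Conf n k) (i) : lapSymbol (-ξ) i = lapSymbol ξ i := by
  simp [lapSymbol]

theorem sobolevSymbol_neg (ξ : Conf n k) : sobolevSymbol α (-ξ) = sobolevSymbol α ξ := by
  simp [sobolevSymbol, lapSymbol_neg]

/-- A symmetry `γ ↦ κ ∘ γ ∘ R` of functions on configuration space that becomes
`F ↦ κ ∘ F ∘ A` for the Fourier transforms. -/
structure FourierSymmetry (n k : ℕ) where
  κ : ℂ ≃ₗᵢ[ℝ] ℂ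
  A : Conf n k ≃ₗᵢ[ℝ] Conf n k
  R : Conf n k ≃ₗᵢ[ℝ] Conf n k
  fourierInv : ∀ (F : Conf n k → ℂ) (z : Conf n k),
    𝓕⁻ (fun ξ => κ (F (A ξ))) z = κ (𝓕⁻ F (R z))
  symbol : ∀ α ξ, sobolevSymbol α (A ξ) = sobolevSymbol α ξ
  prop : ∀ t ξ w, propSymbol t ξ * κ w = κ (propSymbol t (A ξ) * w)

namespace FourierSymmetry

variable (Y : FourierSymmetry n k)

/-- Invariance of `γ` under the symmetry, in position space. -/
def Fixes (γ : Sob n k α) : Prop := ∀ᵐ z : Conf n k, γ.toL2 z = Y.κ (γ.toL2 (Y.R z))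

theorem ae_comp {p : Conf n k → Prop} (B : Conf n k ≃ₗᵢ[ℝ] Conf n k) (h : ∀ᵐ z, p z) :
    ∀ᵐ z, p (B z) :=
  B.measurePreserving.quasiMeasurePreserving.ae h

/-- Both sides have continuous representatives, so equality almost everywhere is equality
everywhere; this permits evaluation on the null sets used by contractions. -/
theorem fixes_iff_rep (hα : (n : ℝ) / 2 < α) (γ : Sob n k α) :
    Y.Fixes γ ↔ ∀ z, γ.rep z = Y.κ (γ.rep (Y.R z)) := by
  have h := γ.toL2_ae_eq_rep hα
  have hR := ae_comp Y.R h
  constructor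
  · intro hf
    have hc := γ.continuous_rep hα
    refine congrFun ((hc.ae_eq_iff_eq volume
      (Y.κ.continuous.comp (hc.comp Y.R.continuous))).1 ?_)
    filter_upwards [hf, h, hR] with z h1 h2 h3
    rw [← h2, h1, h3]
    rfl
  · intro hf
    unfold Fixes
    filter_upwards [h, hR] with z h2 h3
    rw [h2, h3, hf z]

/-- The transformed Fourier data G again lies in the weighted space and defines an element g whose
representative is the transformed representative of γ. Invariance on either side then says g = γ. -/
theorem fixes_iff_fourier (hα : (n : ℝ) / 2 < α) (γ : Sob n k α) :
    Y.Fixes γ ↔ ∀ᵐ ξ : Conf n k, (𝓕 γ.toL2 : L2 n k) ξ = Y.κ ((𝓕 γ.toL2 : L2 n k) (Y.A ξ)) := by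
  have hα0 : 0 ≤ α := le_trans (by positivity) hα.le
  rw [Y.fixes_iff_rep hα]
  set F : Conf n k → ℂ := ((𝓕 γ.toL2 : L2 n k) : Conf n k → ℂ) with hF
  set G : Conf n k → ℂ := fun ξ => Y.κ (F (Y.A ξ)) with hG
  have hFm : AEStronglyMeasurable F volume := Lp.aestronglyMeasurable _
  have hGm : AEStronglyMeasurable G volume := Y.κ.continuous.comp_aestronglyMeasurable
    (hFm.comp_measurePreserving Y.A.measurePreserving)
  have hWG : MemLp (fun ξ => (sobolevSymbol α ξ : ℂ) * G ξ) 2 volume := by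
    refine (γ.memLp.comp_measurePreserving Y.A.measurePreserving).of_le
      ((Complex.continuous_ofReal.comp (continuous_sobolevSymbol α)).aestronglyMeasurable.mul hGm)
      (Filter.Eventually.of_forall fun ξ => ?_)
    simp only [Function.comp, hG, norm_mul, Y.symbol, Y.κ.norm_map]
    exact le_rfl
  obtain ⟨g, hg⟩ := Sob.exists_of_fourier hα0 hGm hWG
  have hgr : ∀ z, g.rep z = Y.κ (γ.rep (Y.R z)) := fun z => by
    rw [Sob.rep, Real.fourierInv_congr_ae hg, hG, Y.fourierInv]
    rfl
  constructor
  · intro h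
    have e : g = γ := by
      refine Sob.ext_toL2 (Lp.ext ?_)
      filter_upwards [g.toL2_ae_eq_rep hα, γ.toL2_ae_eq_rep hα] with z h1 h2
      rw [h1, h2, hgr, ← h z]
    rw [e] at hg
    exact hg
  · intro h z
    rw [← hgr, Sob.rep, Sob.rep]
    exact Real.fourierInv_congr_ae ((show F =ᵐ[volume] G from h).trans hg.symm) z

theorem Fixes.prop {Y : FourierSymmetry n k} (hα : (n : ℝ) / 2 < α) {γ : Sob n k α}
    (h : Y.Fixes γ) (t : ℝ) : Y.Fixes (GP.prop t γ) := by
  rw [Y.fixes_iff_fourier hα] at h ⊢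
  filter_upwards [h, fourier_prop t γ, ae_comp Y.A (fourier_prop t γ)] with ξ h1 h2 h3
  rw [h2, h3, h1, Y.prop]

/-- The symmetry as an operator on `L²`. -/
def op : L2 n k →L[ℝ] L2 n k :=
  (Y.κ.toContinuousLinearEquiv.toContinuousLinearMap.compLpL 2 volume).comp
    (Lp.compMeasurePreservingₗᵢ ℝ Y.R Y.R.measurePreserving).toContinuousLinearMap

theorem coeFn_op (f : L2 n k) : Y.op f =ᵐ[volume] fun z => Y.κ (f (Y.R z)) := by
  have h1 := ContinuousLinearMap.coeFn_compLpL (p := 2) (μ := volume)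
    Y.κ.toContinuousLinearEquiv.toContinuousLinearMap
    (Lp.compMeasurePreserving Y.R Y.R.measurePreserving f)
  filter_upwards [h1, Lp.coeFn_compMeasurePreserving f Y.R.measurePreserving] with z h2 h3
  refine h2.trans ?_
  rw [h3]
  rfl

/-- The closed real subspace of invariant elements. -/
def fixed (hα : 0 ≤ α) : Submodule ℝ (Sob n k α) :=
  ((ContinuousLinearMap.id ℝ (L2 n k) - Y.op).comp ((Sob.toL2L hα).restrictScalars ℝ)).ker

theorem mem_fixed (hα : 0 ≤ α) (γ : Sob n k α) : γ ∈ Y.fixed hα ↔ Y.Fixes γ := by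
  have h : γ ∈ Y.fixed hα ↔ γ.toL2 - Y.op γ.toL2 = 0 := Iff.rfl
  rw [h, sub_eq_zero]
  have hc := Y.coeFn_op γ.toL2
  constructor
  · intro e
    unfold Fixes
    filter_upwards [hc] with z hz
    rw [← hz, ← e]
  · intro e
    exact Lp.ext ((show _ =ᵐ[volume] _ from e).trans hc.symm)

theorem isClosed_fixed (hα : 0 ≤ α) : IsClosed (Y.fixed hα : Set (Sob n k α)) :=
  ContinuousLinearMap.isClosed_ker
    ((ContinuousLinearMap.id ℝ (L2 n k) - Y.op).comp ((Sob.toL2L hα).restrictScalars ℝ))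

end FourierSymmetry

/-- The exchange of all `x_j` and `x'_j`. -/
def swapPerm (k : ℕ) : Equiv.Perm (Fin k ⊕ Fin k) := Equiv.sumComm (Fin k) (Fin k)

@[simp] theorem swapPerm_inl (j : Fin k) : swapPerm k (Sum.inl j) = Sum.inr j := rfl

@[simp] theorem swapPerm_inr (j : Fin k) : swapPerm k (Sum.inr j) = Sum.inl j := rfl

/-- Hermitian symmetry. -/
def hermitianSymmetry (n k : ℕ) : FourierSymmetry n k where
  κ := Complex.conjLIE
  -- Conjugation in position space reflects frequencies, hence the extra negation.
  A := (relabel n (swapPerm k)).trans (LinearIsometryEquiv.neg ℝ)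
  R := relabel n (swapPerm k)
  fourierInv F z := by
    have h1 := Real.fourierInv_comp_linearIsometry
      ((relabel n (swapPerm k)).trans (LinearIsometryEquiv.neg ℝ)) F (-z)
    have h2 : ((relabel n (swapPerm k)).trans (LinearIsometryEquiv.neg ℝ)) (-z) =
        relabel n (swapPerm k) z := by simp
    rw [h2] at h1
    rw [← h1, Real.fourierInv_eq', Real.fourierInv_eq']
    change _ = starRingEnd ℂ _
    rw [← integral_conj]
    refine integral_congr_ae (Filter.Eventually.of_forall fun ξ => ?_)
    simp only [smul_eq_mul, map_mul, ← Complex.exp_conj, Complex.conj_ofReal, Complex.conj_I,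
      inner_neg_right, Complex.conjLIE_apply, Function.comp]
    congr 2
    push_cast
    ring
  symbol α ξ := by
    change sobolevSymbol α (-(relabel n (swapPerm k) ξ)) = _
    rw [sobolevSymbol_neg, sobolevSymbol_relabel]
  prop t ξ w := by
    change _ = starRingEnd ℂ (propSymbol t (-(relabel n (swapPerm k) ξ)) * w)
    -- Conjugation reverses the phase and exchanging primed with unprimed variables reverses it
    -- again.
    simp only [propSymbol, map_mul, ← Complex.exp_conj, Complex.conj_ofReal, Complex.conj_I,
      lapSymbol_neg, lapSymbol_relabel, swapPerm_inl, swapPerm_inr,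
      Complex.conjLIE_apply]
    congr 2
    push_cast
    ring

/-- Symmetry under permutations of the particles. -/
def permSymmetry (n : ℕ) {k : ℕ} (σ : Equiv.Perm (Fin k)) : FourierSymmetry n k where
  κ := LinearIsometryEquiv.refl ℝ ℂ
  A := relabel n (Equiv.sumCongr σ σ)
  R := relabel n (Equiv.sumCongr σ σ)
  fourierInv F z := Real.fourierInv_comp_linearIsometry (relabel n (Equiv.sumCongr σ σ)) F z
  symbol α ξ := sobolevSymbol_relabel _ ξ
  prop t ξ w := by
    change _ = propSymbol t _ * w
    simp only [propSymbol, lapSymbol_relabel, Equiv.sumCongr_apply, Sum.map_inl, Sum.map_inr]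
    rw [Equiv.sum_comp σ fun j => lapSymbol ξ (Sum.inl j),
      Equiv.sum_comp σ fun j => lapSymbol ξ (Sum.inr j)]
    rfl

theorem isSymm_iff (γ : Sob n k α) :
    IsSymm γ ↔ (hermitianSymmetry n k).Fixes γ ∧ ∀ σ, (permSymmetry n σ).Fixes γ := Iff.rfl

theorem IsSymm.prop (hα : (n : ℝ) / 2 < α) {γ : Sob n k α} (h : IsSymm γ) (t : ℝ) :
    IsSymm (prop t γ) :=
  ⟨FourierSymmetry.Fixes.prop (Y := hermitianSymmetry n k) hα h.1 t,
    fun σ => FourierSymmetry.Fixes.prop (Y := permSymmetry n σ) hα (h.2 σ) t⟩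

/-- The closed real subspace of density matrices. -/
def symmSubmodule (hα : 0 ≤ α) : Submodule ℝ (Sob n k α) :=
  (hermitianSymmetry n k).fixed hα ⊓ ⨅ σ, (permSymmetry n σ).fixed hα

theorem mem_symmSubmodule (hα : 0 ≤ α) (γ : Sob n k α) : γ ∈ symmSubmodule hα ↔ IsSymm γ := by
  rw [isSymm_iff, symmSubmodule, Submodule.mem_inf, Submodule.mem_iInf]
  simp only [FourierSymmetry.mem_fixed]

theorem isClosed_symmSubmodule (hα : 0 ≤ α) :
    IsClosed ((symmSubmodule hα : Submodule ℝ (Sob n k α)) : Set (Sob n k α)) := by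
  rw [symmSubmodule, Submodule.coe_inf, Submodule.coe_iInf]
  exact (FourierSymmetry.isClosed_fixed _ hα).inter
    (isClosed_iInter fun σ => FourierSymmetry.isClosed_fixed _ hα)

/-- The extension of a permutation that fixes the last particle. -/
def extendPerm (σ : Equiv.Perm (Fin k)) : Equiv.Perm (Fin (k + 1)) :=
  (finSuccEquivLast.trans (Equiv.optionCongr σ)).trans finSuccEquivLast.symm

@[simp] theorem extendPerm_castSucc (σ : Equiv.Perm (Fin k)) (j : Fin k) :
    extendPerm σ j.castSucc = (σ j).castSucc := by simp [extendPerm]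

@[simp] theorem extendPerm_last (σ : Equiv.Perm (Fin k)) :
    extendPerm σ (Fin.last k) = Fin.last k := by simp [extendPerm]

/-- Permuting before contracting equals contracting at the permuted label and then permuting with
the last particle fixed; this moves the symmetry of γ through each summand of the collision term. -/
theorem contract_relabel_perm (σ : Equiv.Perm (Fin k)) (i : Fin k ⊕ Fin k) (z : Conf n k) :
    contract i (relabel n (Equiv.sumCongr σ σ) z) =
      relabel n (Equiv.sumCongr (extendPerm σ) (extendPerm σ))
        (contract (Equiv.sumCongr σ σ i) z) := by
  simp only [contract_eq_extend]
  apply conf_ext <;> intros <;> simp [relabel_apply]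

theorem contract_relabel_swap (i : Fin k ⊕ Fin k) (z : Conf n k) :
    contract i (relabel n (swapPerm k) z) =
      relabel n (swapPerm (k + 1)) (contract (swapPerm k i) z) := by
  simp only [contract_eq_extend]
  apply conf_ext <;> intros <;> simp [relabel_apply]

/-- `-i μ B^{(k)}` preserves the symmetry of density matrices. -/
theorem IsSymm.collision (hα : (n : ℝ) / 2 < α) (μ : ℝ) {γ : Sob n (k + 1) α} (h : IsSymm γ) :
    IsSymm ((-Complex.I * (μ : ℂ)) • collision hα k γ) := by
  obtain ⟨c, hc, hγ, hg⟩ := isCollision_collision hα γ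
  have hcr : c = γ.rep := (hc.ae_eq_iff_eq volume (γ.continuous_rep hα)).1
    (hγ.symm.trans (γ.toL2_ae_eq_rep hα))
  have hs := ((hermitianSymmetry n (k + 1)).fixes_iff_rep hα γ).1 h.1
  have hp := fun σ => ((permSymmetry n σ).fixes_iff_rep hα γ).1 (h.2 σ)
  rw [← hcr] at hs hp
  set b : Conf n k → ℂ := fun z => (-Complex.I * (μ : ℂ)) *
    ∑ j, (c (contract (Sum.inl j) z) - c (contract (Sum.inr j) z)) with hb
  have hgb : ((-Complex.I * (μ : ℂ)) • GP.collision hα k γ).toL2 =ᵐ[volume] b := by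
    filter_upwards [Sob.toL2_smul (-Complex.I * (μ : ℂ)) (GP.collision hα k γ), hg] with z h1 h2
    rw [h1, h2]
  have key : ∀ Y : FourierSymmetry n k, (∀ z, b z = Y.κ (b (Y.R z))) →
      Y.Fixes ((-Complex.I * (μ : ℂ)) • GP.collision hα k γ) := by
    intro Y hY
    unfold FourierSymmetry.Fixes
    filter_upwards [hgb, FourierSymmetry.ae_comp Y.R hgb] with z h1 h2
    rw [h1, h2, hY]
  refine (isSymm_iff _).2 ⟨key _ fun z => ?_, fun σ => key _ fun z => ?_⟩
  · change b z = starRingEnd ℂ (b (relabel n (swapPerm k) z))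
    have hs' : ∀ z, starRingEnd ℂ (c (relabel n (swapPerm (k + 1)) z)) = c z := fun z => (hs z).symm
    simp only [hb, contract_relabel_swap, map_mul, map_neg, Complex.conj_I, Complex.conj_ofReal,
      map_sum, map_sub, hs', swapPerm_inl, swapPerm_inr]
    -- The exchange swaps the two contractions and so changes the sign of the collision sum;
    -- conjugation of -i compensates.
    rw [neg_neg, neg_mul, neg_mul, ← mul_neg, ← Finset.sum_neg_distrib]
    simp only [neg_sub]
  · change b z = b (relabel n (Equiv.sumCongr σ σ) z)
    have hp' : ∀ z, c (relabel n (Equiv.sumCongr (extendPerm σ) (extendPerm σ)) z) = c z :=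
      fun z => (hp (extendPerm σ) z).symm
    simp only [hb, contract_relabel_perm, hp', Equiv.sumCongr_apply, Sum.map_inl, Sum.map_inr]
    rw [Equiv.sum_comp σ fun j => c (contract (Sum.inl j) z) - c (contract (Sum.inr j) z)]

end Symmetry

/-! ### Suprema over a time interval -/

section SupNorm

variable {F : Type*} [NormedAddCommGroup F]

theorem supNorm_nonneg (T : ℝ) (u : ℝ → F) : 0 ≤ supNorm T u :=
  Real.iSup_nonneg fun _ => norm_nonneg _

theorem supNorm_le {T K : ℝ} (hT : 0 ≤ T) {u : ℝ → F} (h : ∀ t ∈ Icc 0 T, ‖u t‖ ≤ K) :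
    supNorm T u ≤ K :=
  have : Nonempty (Icc (0 : ℝ) T) := ⟨⟨0, le_rfl, hT⟩⟩
  ciSup_le fun t => h t t.2

theorem le_supNorm {T : ℝ} {u : ℝ → F} (hu : ContinuousOn u (Icc 0 T)) {t : ℝ}
    (ht : t ∈ Icc 0 T) : ‖u t‖ ≤ supNorm T u := by
  obtain ⟨K, hK⟩ := isCompact_Icc.exists_bound_of_continuousOn hu
  exact le_ciSup (f := fun t : Icc (0 : ℝ) T => ‖u t‖)
    ⟨K, by rintro _ ⟨s, rfl⟩; exact hK s s.2⟩ ⟨t, ht⟩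

end SupNorm

/-! ### Application to the Gross-Pitaevskii hierarchy -/

variable {n : ℕ} {α : ℝ}

/-- The Gross-Pitaevskii hierarchy as a linear hierarchy of evolution equations. -/
def gpHierarchy (hα : (n : ℝ) / 2 < α) (μ : ℝ) (hμ : |μ| = 1) :
    LinearHierarchy fun k => Sob n (k + 1) α where
  S k t := (propL n (k + 1) α t).restrictScalars ℝ
  B k := ((-Complex.I * (μ : ℂ)) • collision hα (k + 1)).restrictScalars ℝ
  M := collisionConst n α
  S_zero _ := prop_zero
  S_add _ := prop_add_time
  norm_S _ := norm_prop
  continuous_S _ := continuous_prop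
  M_pos := collisionConst_pos
  norm_B k x := by
    change ‖(-Complex.I * (μ : ℂ)) • collision hα (k + 1) x‖ ≤ _
    rw [norm_smul, norm_mul, norm_neg, Complex.norm_I, Complex.norm_real, Real.norm_eq_abs, hμ,
      one_mul, one_mul]
    have := norm_collision_le hα x
    push_cast at this
    exact this

theorem exists_isSolution (hα : (n : ℝ) / 2 < α) {μ : ℝ} (hμ : |μ| = 1) {Γ₀ : Hier n α}
    (hΓ₀ : MemHier Γ₀) {T : ℝ} (hT : 0 < T)
    (hΓT : 4 * (2 * collisionConst n α) * hierNorm Γ₀ * T ≤ 1) :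
    ∃ Γ : ℝ → Hier n α, IsSolution μ T Γ₀ Γ ∧ cHierNorm T Γ ≤ 2 * hierNorm Γ₀ := by
  have hα0 : 0 ≤ α := le_trans (by positivity) hα.le
  have : ∀ k, CompleteSpace (Sob n (k + 1) α) := fun k => Sob.completeSpace n (k + 1) hα0
  set H := gpHierarchy hα μ hμ
  have hM : 0 < H.M := H.M_pos
  have ha0 : ∀ k, 0 ≤ ‖Γ₀ k‖ := fun k => norm_nonneg _
  have hadm : ∀ l, Admissible (fun k => ‖Γ₀ k‖) l → 2 * H.M * l * T ≤ 1 →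
      Admissible (duhamelBound (fun k => ‖Γ₀ k‖) (H.M * T)) (2 * l) := fun l hl h =>
    (duhamelBound_spec ha0 hl (by positivity) (mul_pos two_pos hl.1) (H.scale_bound hl.1 h)).2
  -- Any positive ε serves here: `l₀` only secures convergence, and the sharp quasi-norm bound comes
  -- from `hadm'` for all suitable `l`.
  obtain ⟨l₀, hl₀, hlT₀, -⟩ := exists_admissible_le ha0 hΓ₀.2 hM hT hΓT one_pos
  obtain ⟨u, huc, huV, hu, hub⟩ := H.exists_solution Γ₀ hT hl₀ hlT₀
    (fun k => symmSubmodule hα0) (fun k => isClosed_symmSubmodule hα0)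
    (fun k t y hy => (mem_symmSubmodule hα0 _).2 (((mem_symmSubmodule hα0 _).1 hy).prop hα t))
    (fun k y hy => (mem_symmSubmodule hα0 _).2 (((mem_symmSubmodule hα0 _).1 hy).collision hα μ))
    (fun k => (mem_symmSubmodule hα0 _).2 (hΓ₀.1 k))
  have hsup : ∀ k, supNorm T (fun t => u k t) ≤ duhamelBound (fun k => ‖Γ₀ k‖) (H.M * T) k :=
    fun k => supNorm_le hT.le fun t _ => hub k t
  have hadm' : ∀ l, Admissible (fun k => ‖Γ₀ k‖) l → 2 * H.M * l * T ≤ 1 →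
      Admissible (fun k => supNorm T fun t => u k t) (2 * l) := fun l hl h =>
    (hadm l hl h).of_le (fun k => supNorm_nonneg T _) hsup
  refine ⟨fun t k => u k t, ⟨⟨fun t _ k => (mem_symmSubmodule hα0 _).1 (huV k t),
    fun k => (huc k).continuousOn, (hadm' l₀ hl₀ hlT₀).seqMem⟩, fun k =>
    ⟨fun s => collision hα (k + 1) (u (k + 1) s), fun s _ => isCollision_collision hα _,
    fun t ht => ⟨(H.continuous_duhamel_integrand k (huc (k + 1)) t).intervalIntegrable 0 t,
      hu k t ht⟩⟩⟩, ?_⟩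
  exact seqNorm_le_two_mul ha0 hΓ₀.2 hM hT hΓT hadm'

theorem IsSolution.initial {μ T : ℝ} (hT : 0 ≤ T) {Γ₀ : Hier n α} {Γ : ℝ → Hier n α}
    (h : IsSolution μ T Γ₀ Γ) (k : ℕ) : Γ 0 k = Γ₀ k := by
  obtain ⟨b, -, hb⟩ := h.2 k
  rw [(hb 0 ⟨le_rfl, hT⟩).2, intervalIntegral.integral_same, add_zero, prop_zero]

theorem IsSolution.seqMem_sub {μ T : ℝ} (hT : 0 ≤ T) {Γ₀ Γ₀' : Hier n α}
    {Γ Γ' : ℝ → Hier n α} (h : IsSolution μ T Γ₀ Γ) (h' : IsSolution μ T Γ₀' Γ') :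
    SeqMem fun k => supNorm T fun t => (Γ - Γ') t k := by
  refine (SeqMem.add (fun k => supNorm_nonneg T _) (fun k => supNorm_nonneg T _)
    h.1.2.2 h'.1.2.2).of_le (fun k => supNorm_nonneg T _) fun k => ?_
  refine supNorm_le hT fun t ht => (norm_sub_le _ _).trans ?_
  exact add_le_add (le_supNorm (h.1.2.1 k) ht) (le_supNorm (h'.1.2.1 k) ht)

/-- By `IsCollision.unique` the collision terms of any solution coincide with the operator
`collision`, so linearity applies to the difference. -/
theorem IsSolution.sub_eq (hα : (n : ℝ) / 2 < α) {μ : ℝ} (hμ : |μ| = 1) {T : ℝ}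
    {Γ₀ Γ₀' : Hier n α} {Γ Γ' : ℝ → Hier n α} (h : IsSolution μ T Γ₀ Γ)
    (h' : IsSolution μ T Γ₀' Γ') (k : ℕ) {t : ℝ} (ht : t ∈ Icc 0 T) :
    Γ t k - Γ' t k = prop t (Γ₀ k - Γ₀' k) +
      (gpHierarchy hα μ hμ).duhamel k (fun s => Γ s (k + 1) - Γ' s (k + 1)) t := by
  obtain ⟨b, hbc, hb⟩ := h.2 k
  obtain ⟨b', hbc', hb'⟩ := h'.2 k
  have e : (gpHierarchy hα μ hμ).duhamel k (fun s => Γ s (k + 1) - Γ' s (k + 1)) t =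
      ∫ s in (0 : ℝ)..t, (prop (t - s) ((-Complex.I * (μ : ℂ)) • b s) -
        prop (t - s) ((-Complex.I * (μ : ℂ)) • b' s)) := by
    refine intervalIntegral.integral_congr fun s hs => ?_
    rw [uIcc_of_le ht.1] at hs
    have hsT : s ∈ Icc 0 T := ⟨hs.1, hs.2.trans ht.2⟩
    have h1 := (hbc s hsT).unique (isCollision_collision hα _)
    have h2 := (hbc' s hsT).unique (isCollision_collision hα _)
    change propL n (k + 1) α (t - s) ((-Complex.I * (μ : ℂ)) •
      collision hα (k + 1) (Γ s (k + 1) - Γ' s (k + 1))) = _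
    rw [map_sub, smul_sub, map_sub, ← h1, ← h2]
    rfl
  have e0 : prop t (Γ₀ k - Γ₀' k) = prop t (Γ₀ k) - prop t (Γ₀' k) :=
    map_sub (propL n (k + 1) α t) _ _
  rw [e, intervalIntegral.integral_sub (hb t ht).1 (hb' t ht).1, (hb t ht).2, (hb' t ht).2, e0]
  abel

theorem cHierNorm_sub_le (hα : (n : ℝ) / 2 < α) {μ : ℝ} (hμ : |μ| = 1) {Γ₀ Γ₀' : Hier n α}
    {T₀ : ℝ} {Γ Γ' : ℝ → Hier n α} (h : IsSolution μ T₀ Γ₀ Γ) (h' : IsSolution μ T₀ Γ₀' Γ')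
    {T : ℝ} (hT : 0 < T) (hTT : T ≤ T₀)
    (hΓT : 4 * (2 * collisionConst n α) * cHierNorm T₀ (Γ - Γ') * T ≤ 1) :
    cHierNorm T (Γ - Γ') ≤ 2 * hierNorm (Γ₀ - Γ₀') := by
  have hα0 : 0 ≤ α := le_trans (by positivity) hα.le
  have hT₀ : 0 ≤ T₀ := hT.le.trans hTT
  have : ∀ k, CompleteSpace (Sob n (k + 1) α) := fun k => Sob.completeSpace n (k + 1) hα0
  set H := gpHierarchy hα μ hμ
  have hM : 0 < H.M := H.M_pos
  have hb := h.seqMem_sub hT₀ h'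
  set b : ℕ → ℝ := fun k => supNorm T₀ fun t => (Γ - Γ') t k
  have hb0 : ∀ k, 0 ≤ b k := fun k => supNorm_nonneg T₀ _
  have hDb : ∀ k, ∀ t ∈ Icc 0 T₀, ‖Γ t k - Γ' t k‖ ≤ b k := fun k t ht =>
    le_supNorm (u := fun t => (Γ - Γ') t k) ((h.1.2.1 k).sub (h'.1.2.1 k)) ht
  have ha0 : ∀ k, 0 ≤ ‖(Γ₀ - Γ₀') k‖ := fun k => norm_nonneg _
  have hab : ∀ k, ‖(Γ₀ - Γ₀') k‖ ≤ b k := fun k => by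
    have := hDb k 0 ⟨le_rfl, hT₀⟩
    rwa [h.initial hT₀, h'.initial hT₀] at this
  have hle : hierNorm (Γ₀ - Γ₀') ≤ cHierNorm T₀ (Γ - Γ') := seqNorm_mono hb ha0 hab
  have hΓT' : 4 * (2 * H.M) * seqNorm (fun k => ‖(Γ₀ - Γ₀') k‖) * T ≤ 1 := by
    refine le_trans ?_ hΓT
    exact mul_le_mul_of_nonneg_right (mul_le_mul_of_nonneg_left hle (by positivity)) hT.le
  -- `l₁` refers to the size of the difference on all of `[0, T₀]` and serves only to make the
  -- Duhamel remainder vanish; the final bound uses values admissible for the initial difference.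
  obtain ⟨l₁, hl₁, hlT₁, -⟩ := exists_admissible_le hb0 hb hM hT hΓT one_pos
  set p : ℝ → ℝ := fun t => (projIcc 0 T hT.le t : ℝ) with hp
  have hpm : ∀ t, p t ∈ Icc 0 T₀ := fun t =>
    ⟨(projIcc 0 T hT.le t).2.1, (projIcc 0 T hT.le t).2.2.trans hTT⟩
  have hpe : ∀ t ∈ Icc 0 T, p t = t := fun t ht => by simp only [hp, projIcc_of_mem hT.le ht]
  have hpc : Continuous p := continuous_subtype_val.comp continuous_projIcc
  set u : ∀ k, ℝ → Sob n (k + 1) α := fun k t => Γ (p t) k - Γ' (p t) k with hu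
  have huc : ∀ k, Continuous (u k) := fun k =>
    ((h.1.2.1 k).sub (h'.1.2.1 k)).comp_continuous hpc hpm
  have heq : ∀ k, ∀ t ∈ Icc 0 T, u k t = H.free (Γ₀ - Γ₀') k t + H.duhamel k (u (k + 1)) t := by
    intro k t ht
    rw [H.duhamel_congr k (T := T) (v := fun s => Γ s (k + 1) - Γ' s (k + 1))
      (fun s hs => by simp only [hu, hpe s hs]) ht]
    simp only [hu, hpe t ht]
    exact h.sub_eq hα hμ h' k ⟨ht.1, ht.2.trans hTT⟩
  have hbound : ∀ k, supNorm T (fun t => (Γ - Γ') t k) ≤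
      duhamelBound (fun k => ‖(Γ₀ - Γ₀') k‖) (H.M * T) k := fun k =>
    supNorm_le hT.le fun t ht => by
      have := H.norm_le_of_solution hT huc heq hb0 (fun k t _ => hDb k _ (hpm t)) hl₁ hlT₁ k ht
      simp only [hu, hpe t ht] at this
      exact this
  refine seqNorm_le_two_mul ha0 (hb.of_le ha0 hab) hM hT hΓT' fun l hl hlT => ?_
  exact (duhamelBound_spec ha0 hl (by positivity) (mul_pos two_pos hl.1)
    (H.scale_bound hl.1 hlT)).2.of_le (fun k => supNorm_nonneg T _) hbound

end GP

end

theorem theorem2p1 (n : ℕ) (hn : 1 ≤ n) (α : ℝ) (hα : (n : ℝ) / 2 < α) :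
    ∃ C : ℝ, 0 < C ∧ ∀ μ : ℝ, μ = 1 ∨ μ = -1 →
      (∀ Γ₀ : GP.Hier n α, GP.MemHier Γ₀ →
        ∀ T : ℝ, 0 < T → 4 * C * GP.hierNorm Γ₀ * T ≤ 1 →
          ∃ Γ : ℝ → GP.Hier n α, GP.IsSolution μ T Γ₀ Γ ∧
            GP.cHierNorm T Γ ≤ 2 * GP.hierNorm Γ₀) ∧
      (∀ Γ₀ Γ₀' : GP.Hier n α, GP.MemHier Γ₀ → GP.MemHier Γ₀' →
        ∀ T₀ : ℝ, 0 < T₀ → ∀ Γ Γ' : ℝ → GP.Hier n α,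
          GP.IsSolution μ T₀ Γ₀ Γ → GP.IsSolution μ T₀ Γ₀' Γ' →
            ∀ T : ℝ, 0 < T → T ≤ T₀ → 4 * C * GP.cHierNorm T₀ (Γ - Γ') * T ≤ 1 →
              GP.cHierNorm T (Γ - Γ') ≤ 2 * GP.hierNorm (Γ₀ - Γ₀')) := by
  -- At the infimum `l = 2‖Γ₀‖` the condition 2MlT ≤ 1 would correspond to C = M; the factor 2
  -- leaves room for `l` slightly above the infimum.
  refine ⟨2 * GP.collisionConst n α, mul_pos two_pos GP.collisionConst_pos, fun μ hμ => ?_⟩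
  have hμ1 : |μ| = 1 := by rcases hμ with rfl | rfl <;> simp
  exact ⟨fun Γ₀ hΓ₀ T hT hΓT => GP.exists_isSolution hα hμ1 hΓ₀ hT hΓT,
    fun Γ₀ Γ₀' _ _ T₀ _ Γ Γ' h h' T hT hTT hΓT => GP.cHierNorm_sub_le hα hμ1 h h' hT hTT hΓT⟩
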